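/- Let $k\ge 1$ be an integer. For $x>0$ and $s,u\in\mathbb{C}$ with $\frac12<\Re(s)<\Re(u)$ let $$F_2(s,u,k;x)=-i^k\frac{1}{2\pi i}\int_{(-\Re(s)-\epsilon)}\frac{\Gamma(u+v)}{\Gamma(1+u-v)}\,\frac{\Gamma\left(1-s-v+\frac{k-1}{2}\right)}{\Gamma\left(s+v+\frac{k-1}{2}\right)}\,x^v\,dv ,$$ where $(\sigma)$ denotes the upward line $\Re(v)=\sigma$, $\epsilon>0$ is any number with $\Re(s)+\epsilon<\Re(u)$, and $1/\Gamma$ is the entire function that vanishes at $0,-1,-2,\dots$. The integral converges absolutely, and the following holds. **(1) Explicit formulas.** For $\frac12<\Re(s)<\Re(u)$ and every such $\epsilon$: if $x>1$, $$F_2(s,u,k;x)=-i^k\frac{\Gamma\left(1-s+u+\frac{k-1}{2}\right)}{\Gamma\left(s-u+\frac{k-1}{2}\right)\Gamma(1+2u)}\,x^{-u}\,{}_2F_1\!\left({1-s+u+\frac{k-1}{2},\,1-s+u-\frac{k-1}{2}\atop 1+2u};x^{-1}\right);$$ if $x=1$, $$F_2(s,u,k;1)=-i^k\,\Gamma(2s-1)\,\frac{\sin\left(\pi\left(s+u-\frac{k-1}{2}\right)\right)}{\pi}\,\frac{\Gamma\left(1-s-u+\frac{k-1}{2}\right)\Gamma\left(1-s+u+\frac{k-1}{2}\right)}{\Gamma\left(s+u+\frac{k-1}{2}\right)\Gamma\left(s-u+\frac{k-1}{2}\right)},$$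 where, if $1-s-u+\frac{k-1}{2}\in\mathbb{Z}_{\le 0}$, the product $\frac{1}{\pi}\sin\left(\pi\left(s+u-\frac{k-1}{2}\right)\right)\Gamma\left(1-s-u+\frac{k-1}{2}\right)$ is read as its limiting value $1/\Gamma\left(s+u-\frac{k-1}{2}\right)$; if $0<x<1$, $$F_2(s,u,k;x)=-i^k\frac{\Gamma\left(1-s+u+\frac{k-1}{2}\right)}{\Gamma\left(s+u-\frac{k-1}{2}\right)\Gamma(k)}\,x^{1-s+\frac{k-1}{2}}\,{}_2F_1\!\left({1-s+u+\frac{k-1}{2},\,1-s-u+\frac{k-1}{2}\atop k};x\right).$$ Here ${}_2F_1$ is the Gauss hypergeometric series. **(2) Meromorphic continuation.** For each $x>0$ the function $F_2(s,u,k;x)$ has a meromorphic continuation to $(s,u)\in\mathbb{C}^2$, again denoted by $F_2$. It is holomorphic at every point with $1-s+u+\frac{k-1}{2}\notin\mathbb{Z}_{\le0}$ and, when $x=1$, also $2s-1\notin\mathbb{Z}_{\le0}$. At these points it is given by the formulas of (1), provided in addition that $1+2u\notin\mathbb{Z}_{\le0}$ when $x>1$ and that $1-s-u+\frac{k-1}{2}\notin\mathbb{Z}_{\le0}$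 when $x=1$. **(3) Integral representations and bound.** Let $\Re(s)\ge\frac12$ and $\Re(s)<\Re(u)$. If $x>1$ and $-1+\Re(s)-\frac{k-1}{2}<\sigma_v<\Re(u)$, then $$F_2(s,u,k;x)=-i^k\,\frac{\sin\left(\pi\left(s-u+\frac{k-1}{2}\right)\right)}{\pi}\,\frac{\Gamma\left(1-s+u-\frac{k-1}{2}\right)}{\Gamma\left(s+u+\frac{k-1}{2}\right)}\left(\frac{x}{x-1}\right)^{1-s+\frac{k-1}{2}}\frac{1}{2\pi i}\int_{(\sigma_v)}\frac{\Gamma\left(1-s+\frac{k-1}{2}+v\right)\Gamma\left(s+\frac{k-1}{2}+v\right)\Gamma(u-v)}{\Gamma(1+u+v)}(x-1)^{-v}\,dv,$$ where, if $1-s+u-\frac{k-1}{2}\in\mathbb{Z}_{\le0}$, the product $\frac1\pi\sin\left(\pi\left(s-u+\frac{k-1}{2}\right)\right)\Gamma\left(1-s+u-\frac{k-1}{2}\right)$ is read as its limiting value $1/\Gamma\left(s-u+\frac{k-1}{2}\right)$. Moreover there is a constant $C=C(s,u,k)$ such that for all $x>1$ $$\left|\left(\frac{x}{x-1}\right)^{-1+s-\frac{k-1}{2}}F_2(s,u,k;x)\right|\le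 C\,(x-1)^{-\Re(u)} .$$ If $0<x<1$ and $-1+\Re(s)-\frac{k-1}{2}<\sigma_v<-|\Re(u)|$, then $$F_2(s,u,k;x)=-i^k\,\frac{\sin\left(\pi\left(s+u-\frac{k-1}{2}\right)\right)}{\pi}\,\frac{1}{\Gamma\left(s-u+\frac{k-1}{2}\right)\Gamma\left(s+u+\frac{k-1}{2}\right)}\left(\frac{x}{1-x}\right)^{1-s+\frac{k-1}{2}}\frac{1}{2\pi i}\int_{(\sigma_v)}\Gamma(u-v)\,\Gamma(-u-v)\,\Gamma\left(s+\tfrac{k-1}{2}+v\right)\Gamma\left(1-s+\tfrac{k-1}{2}+v\right)(1-x)^{-v}\,dv .$$ The integrals in (3) converge absolutely. -/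

import Mathlib

open Complex MeasureTheory

noncomputable section

/-- The vertical line integral `(1 / (2πi)) ∫_{(σ)} f(v) dv`, where the line `Re v = σ` is
parametrized as `v = σ + i t`, so that `dv = i dt`. -/
def verticalIntegral (σ : ℝ) (f : ℂ → ℂ) : ℂ :=
  1 / (2 * (Real.pi : ℂ) * I) * ∫ t : ℝ, f ((σ : ℂ) + (t : ℂ) * I) * I

/-- The shift `(k - 1) / 2` attached to the weight `k`. -/
def weightShift (k : ℕ) : ℂ := ((k : ℂ) - 1) / 2

/-- `z` is not one of `0, -1, -2, …`, that is, `z` is not a pole of the Gamma function. -/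
def NotGammaPole (z : ℂ) : Prop := ∀ m : ℕ, z ≠ -(m : ℂ)

/-- The integrand of `F₂(s, u, k; x)`, without the factor `-i^k`. -/
def F2Integrand (s u : ℂ) (k : ℕ) (x : ℝ) (v : ℂ) : ℂ :=
  Gamma (u + v) / Gamma (1 + u - v)
    * (Gamma (1 - s - v + weightShift k) / Gamma (s + v + weightShift k)) * (x : ℂ) ^ v

/-- `F₂(s, u, k; x)` as an integral over the line `Re v = -Re s - ε`. -/
def F2 (ε : ℝ) (s u : ℂ) (k : ℕ) (x : ℝ) : ℂ :=
  -I ^ k * verticalIntegral (-s.re - ε) (F2Integrand s u k x)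

/-- The hypergeometric expression for `x > 1`. -/
def F2HypLarge (s u : ℂ) (k : ℕ) (x : ℝ) : ℂ :=
  -I ^ k * (Gamma (1 - s + u + weightShift k) /
      (Gamma (s - u + weightShift k) * Gamma (1 + 2 * u)))
    * (x : ℂ) ^ (-u)
    * ordinaryHypergeometric (1 - s + u + weightShift k) (1 - s + u - weightShift k) (1 + 2 * u)
        ((x : ℂ)⁻¹)

/-- The closed Gamma expression for `x = 1`. -/
def F2AtOne (s u : ℂ) (k : ℕ) : ℂ :=
  -I ^ k * Gamma (2 * s - 1) * (Complex.sin (Real.pi * (s + u - weightShift k)) / Real.pi)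
    * (Gamma (1 - s - u + weightShift k) * Gamma (1 - s + u + weightShift k) /
        (Gamma (s + u + weightShift k) * Gamma (s - u + weightShift k)))

/-- The hypergeometric expression for `0 < x < 1`. -/
def F2HypSmall (s u : ℂ) (k : ℕ) (x : ℝ) : ℂ :=
  -I ^ k * (Gamma (1 - s + u + weightShift k) /
      (Gamma (s + u - weightShift k) * Gamma (k : ℂ)))
    * (x : ℂ) ^ (1 - s + weightShift k)
    * ordinaryHypergeometric (1 - s + u + weightShift k) (1 - s - u + weightShift k) (k : ℂ)
        (x : ℂ)

/-- The integrand of the Barnes integral for `x > 1`. -/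
def barnesIntegrandLarge (s u : ℂ) (k : ℕ) (x : ℝ) (v : ℂ) : ℂ :=
  Gamma (1 - s + weightShift k + v) * Gamma (s + weightShift k + v) * Gamma (u - v)
    / Gamma (1 + u + v) * ((x - 1 : ℝ) : ℂ) ^ (-v)

/-- The integrand of the Barnes integral for `0 < x < 1`. -/
def barnesIntegrandSmall (s u : ℂ) (k : ℕ) (x : ℝ) (v : ℂ) : ℂ :=
  Gamma (u - v) * Gamma (-u - v) * Gamma (s + weightShift k + v)
    * Gamma (1 - s + weightShift k + v) * ((1 - x : ℝ) : ℂ) ^ (-v)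

/-- A function of two complex variables is holomorphic at `p` if it is complex (Fréchet)
differentiable at all points of a neighbourhood of `p`. -/
def HolomorphicNear (f : ℂ × ℂ → ℂ) (p : ℂ × ℂ) : Prop :=
  ∃ U : Set (ℂ × ℂ), IsOpen U ∧ p ∈ U ∧ DifferentiableOn ℂ f U

/-- `f` is meromorphic on `ℂ²`: near each point it is a quotient `g / h` of holomorphic functions,
where `h` does not vanish identically on any nonempty open set. The values of `f` are unconstrained
on the nowhere dense set where the denominator vanishes. -/
def MeromorphicOnC2 (f : ℂ × ℂ → ℂ) : Prop :=
  ∀ p : ℂ × ℂ, ∃ (U : Set (ℂ × ℂ)) (g h : ℂ × ℂ → ℂ), IsOpen U ∧ p ∈ U ∧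
    DifferentiableOn ℂ g U ∧ DifferentiableOn ℂ h U ∧ U ⊆ closure {q | h q ≠ 0} ∧
    ∀ q ∈ U, h q ≠ 0 → f q = g q / h q

end

section MellinBarnes

open Filter Asymptotics Topology

/-! Put κ = (k-1)/2. The integrand of F₂ is Γ(p+v)Γ(q-v)/(Γ(b+v)Γ(c-v)) times (1/x)^(-v) with p = u,
q = 1-s+κ, b = s+κ, c = 1+u, so F₂ is an inverse Mellin transform at 1/x. On a vertical line the
exponential factors of the four Gammas cancel and |t|^(-Re(b+c-p-q)) = |t|^(-2 Re s) remains, whence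
absolute convergence for Re s > 1/2. This rests on the two-sided size of Gamma on vertical lines
(`isTheta_Gamma_vertical`).

No residues are summed. Γ(p+v)/Γ(b+v) is the Mellin transform of a truncated power and Γ(q-v)/Γ(c-v)
is a Beta integral; exchanging integrals leaves Euler's integral for ₂F₁
(`mellinInv_gammaQuotient_base`). This requires b and c to be large enough. For the other parameters
one differentiates z^c or z^(-b) times the identity: on both sides this lowers c or b by one
(`mellinInv_gammaQuotient`). The substitution v ↦ -v exchanges z and 1/z, so the same theorem serves
x > 1 and x < 1. At x = 1 the integral is continuous and Euler's integral has a Beta integral as its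
limit, which is Gauss's summation (`mellinInv_gammaQuotient_one`).

The series normalized by 1/Γ(c+n) is entire in its parameters
(`differentiable_regularizedGaussHGFun`). Hence each explicit formula is an entire function of (s,u)
divided by 1/Γ(1-s+u+κ), and by 1/Γ(2s-1) when x = 1; this quotient is the continuation.

The integrals of part (3) are computed by the same exchange of integrals (`mellinInv_barnes_three`,
`mellinInv_barnes_four`) and give the same hypergeometric functions at 1/x and x, so comparing them
with the continuation is algebra of Gamma factors. For the bound, the hypergeometric formula handles
x ≥ 2 and the Barnes integral on the line Re v = Re s handles 1 < x < 2. -/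

/-! ### Size of the Gamma function on vertical lines. -/

lemma norm_Gamma_half_le (t : ℝ) :
    ‖Gamma (1 / 2 + t * I)‖ ≤ √(2 * Real.pi) * Real.exp (-(Real.pi / 2 * |t|)) := by
  have h1 : Gamma (1 / 2 + t * I) * Gamma (1 - (1 / 2 + t * I))
      = Real.pi / Complex.sin (Real.pi * (1 / 2 + t * I)) := Complex.Gamma_mul_Gamma_one_sub _
  have h2 : (1 - (1 / 2 + t * I) : ℂ) = (starRingEnd ℂ) (1 / 2 + t * I) := by
    apply Complex.ext <;> simp
    norm_num
  have h3 : Complex.sin (Real.pi * (1 / 2 + t * I)) = (Real.cosh (Real.pi * t) : ℂ) := by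
    rw [show (Real.pi * (1 / 2 + t * I) : ℂ) = (Real.pi * t : ℝ) * I + Real.pi / 2 by
      push_cast; ring, Complex.sin_add_pi_div_two, Complex.cos_mul_I, Complex.ofReal_cosh]
  rw [h2, Complex.Gamma_conj, Complex.mul_conj, h3] at h1
  have h4 : Complex.normSq (Gamma (1 / 2 + t * I)) = Real.pi / Real.cosh (Real.pi * t) := by
    exact_mod_cast h1
  rw [Complex.normSq_eq_norm_sq] at h4
  have hc : Real.exp (Real.pi * |t|) / 2 ≤ Real.cosh (Real.pi * t) := by
    rw [← Real.cosh_abs, abs_mul, abs_of_pos Real.pi_pos, Real.cosh_eq]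
    have := Real.exp_pos (-(Real.pi * |t|))
    linarith
  have h5 : ‖Gamma (1 / 2 + t * I)‖ ^ 2
      ≤ (√(2 * Real.pi) * Real.exp (-(Real.pi / 2 * |t|))) ^ 2 := by
    rw [h4, mul_pow, Real.sq_sqrt (by positivity), ← Real.exp_nat_mul,
      div_le_iff₀ (Real.cosh_pos _)]
    have : (Real.exp ((2 : ℕ) * -(Real.pi / 2 * |t|))) * (Real.exp (Real.pi * |t|)) = 1 := by
      rw [← Real.exp_add]; simp; ring
    have hp := Real.exp_pos ((2 : ℕ) * -(Real.pi / 2 * |t|))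
    nlinarith [mul_le_mul_of_nonneg_left hc hp.le, Real.pi_pos]
  exact (abs_le_of_sq_le_sq' h5 (by positivity)).2

lemma norm_Gamma_three_halves_le (t : ℝ) :
    ‖Gamma (3 / 2 + t * I)‖
      ≤ (1 / 2 + |t|) * (√(2 * Real.pi) * Real.exp (-(Real.pi / 2 * |t|))) := by
  have h : (3 / 2 + t * I : ℂ) = (1 / 2 + t * I) + 1 := by ring
  have h0 : (1 / 2 + t * I : ℂ) ≠ 0 := by
    intro h; have := congrArg Complex.re h; simp at this
  rw [h, Complex.Gamma_add_one _ h0, norm_mul]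
  gcongr
  · refine (norm_add_le _ _).trans ?_
    simp
  · exact norm_Gamma_half_le t

lemma norm_Gamma_le_of_re_pos {z : ℂ} (hz : 0 < z.re) : ‖Gamma z‖ ≤ Real.Gamma z.re := by
  rw [Complex.Gamma_eq_integral hz, Real.Gamma_eq_integral hz, Complex.GammaIntegral]
  refine (norm_integral_le_integral_norm _).trans (le_of_eq ?_)
  refine setIntegral_congr_fun measurableSet_Ioi fun x hx => ?_
  simp only [norm_mul, Complex.norm_cpow_eq_rpow_re_of_pos (Set.mem_Ioi.mp hx)]
  simp [-Complex.ofReal_neg]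

-- Interpolation between the lines Re = 1/2 and Re = 3/2 by the three lines theorem, applied for
-- fixed t to w ↦ Γ(1/2 + w + it) exp(w²). The Gaussian outweighs the loss exp(π|y|/2) caused by
-- moving to height t + y, so the edge bounds depend on t alone; at the real point w = θ it is at
-- least 1 and can be dropped.
open Complex.HadamardThreeLines in
lemma exists_norm_Gamma_strip_le : ∃ C : ℝ, 0 < C ∧ ∀ θ t : ℝ, 0 ≤ θ → θ ≤ 1 → 1 ≤ |t| →
    ‖Gamma ((1 / 2 + θ : ℝ) + t * I)‖ ≤ C * |t| ^ θ * Real.exp (-(Real.pi / 2 * |t|)) := by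
  have hpi := Real.pi_pos
  have hpi4 := Real.pi_le_four
  -- The exponent 4 bounds both 2|y| - y² (left edge) and 3|y| + 1 - y² (right edge). The factor 2
  -- comes from 1/2 + |t + y| ≤ 2|t| exp|y|, where |t| ≥ 1 is used.
  refine ⟨2 * √(2 * Real.pi) * Real.exp 4, by positivity, fun θ t h0 h1 ht => ?_⟩
  set E := Real.exp (-(Real.pi / 2 * |t|)) with hE
  set C := 2 * √(2 * Real.pi) * Real.exp 4 with hC
  have hEpos : 0 < E := Real.exp_pos _
  have hCpos : 0 < C := by positivity
  let f : ℂ → ℂ := fun w => Gamma (1 / 2 + w + t * I) * Complex.exp (w ^ 2)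
  have hre : ∀ w : ℂ, (1 / 2 + w + t * I : ℂ).re = 1 / 2 + w.re := by intro w; simp
  have hdiff : ∀ w : ℂ, 0 ≤ w.re → DifferentiableAt ℂ f w := by
    intro w hw
    refine DifferentiableAt.mul (DifferentiableAt.comp w (Complex.differentiableAt_Gamma _ ?_)
      (by fun_prop)) (by fun_prop)
    intro m h
    have := congrArg Complex.re h
    rw [hre] at this
    simp at this
    have hm : (0 : ℝ) ≤ m := m.cast_nonneg
    linarith
  have hnormexp : ∀ w : ℂ, ‖Complex.exp (w ^ 2)‖ = Real.exp (w.re ^ 2 - w.im ^ 2) := by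
    intro w
    rw [Complex.norm_exp]; congr 1
    simp [sq]
  have hE' : ∀ y : ℝ, Real.exp (-(Real.pi / 2 * |t + y|)) ≤ E * Real.exp (2 * |y|) := by
    intro y
    rw [hE, ← Real.exp_add, Real.exp_le_exp]
    have h1 : |t| ≤ |t + y| + |y| := by
      have := abs_sub (t + y) y
      simpa using this
    nlinarith [abs_nonneg y, abs_nonneg t]
  have hd : DiffContOnCl ℂ f (verticalStrip 0 1) := by
    refine ⟨fun w hw => (hdiff w hw.1.le).differentiableWithinAt, ?_⟩
    intro w hw
    refine (hdiff w ?_).continuousAt.continuousWithinAt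
    rw [verticalStrip, Complex.closure_preimage_re, closure_Ioo zero_ne_one] at hw
    exact hw.1
  have hB : BddAbove ((norm ∘ f) '' verticalClosedStrip 0 1) := by
    have hcont : ContinuousOn (fun x : ℝ => Real.Gamma (1 / 2 + x)) (Set.Icc 0 1) := by
      intro x hx
      refine (ContinuousAt.comp (Real.differentiableAt_Gamma ?_).continuousAt
        (by fun_prop)).continuousWithinAt
      intro m h
      have hm : (0 : ℝ) ≤ m := m.cast_nonneg
      linarith [hx.1]
    obtain ⟨M, hM⟩ := isCompact_Icc.exists_bound_of_continuousOn hcont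
    refine ⟨M * Real.exp 1, ?_⟩
    rintro _ ⟨w, hw, rfl⟩
    simp only [Function.comp, f, norm_mul]
    have hw' : 0 ≤ w.re ∧ w.re ≤ 1 := hw
    gcongr
    · exact (norm_nonneg _).trans (hM 0 (by simp))
    · refine (norm_Gamma_le_of_re_pos (by rw [hre]; linarith)).trans ?_
      rw [hre]
      exact (le_abs_self _).trans (hM _ hw)
    · rw [hnormexp, Real.exp_le_exp]
      nlinarith [sq_nonneg w.im]
  have ha : ∀ z ∈ Complex.re ⁻¹' {(0 : ℝ)}, ‖f z‖ ≤ C * E := by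
    intro z hz
    have hz0 : z.re = 0 := hz
    have hz' : (1 / 2 + z + t * I : ℂ) = 1 / 2 + ((t + z.im : ℝ) : ℂ) * I := by
      apply Complex.ext <;> simp [hz0]; ring
    simp only [f, norm_mul, hnormexp, hz0, hz']
    calc _ ≤ √(2 * Real.pi) * (E * Real.exp (2 * |z.im|)) * Real.exp (0 ^ 2 - z.im ^ 2) := by
          gcongr
          exact (norm_Gamma_half_le _).trans (by gcongr; exact hE' _)
      _ = √(2 * Real.pi) * E * Real.exp (2 * |z.im| - z.im ^ 2) := by
          rw [sub_eq_add_neg (2 * |z.im|), Real.exp_add]; ring_nf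
      _ ≤ √(2 * Real.pi) * E * Real.exp 4 := by
          gcongr
          nlinarith [sq_nonneg (|z.im| - 1), sq_abs z.im]
      _ ≤ C * E := by
          rw [hC]
          have : 0 < √(2 * Real.pi) * E * Real.exp 4 := by positivity
          nlinarith
  have hb : ∀ z ∈ Complex.re ⁻¹' {(1 : ℝ)}, ‖f z‖ ≤ C * |t| * E := by
    intro z hz
    have hz0 : z.re = 1 := hz
    have hz' : (1 / 2 + z + t * I : ℂ) = 3 / 2 + ((t + z.im : ℝ) : ℂ) * I := by
      apply Complex.ext <;> simp [hz0]
      · norm_num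
      · ring
    simp only [f, norm_mul, hnormexp, hz0, hz']
    have h2 : 1 / 2 + |t + z.im| ≤ |t| * (2 * Real.exp |z.im|) := by
      have h3 := abs_add_le t z.im
      have h4 := Real.add_one_le_exp |z.im|
      nlinarith [abs_nonneg z.im, abs_nonneg t]
    calc _ ≤ (|t| * (2 * Real.exp |z.im|)) *
          (√(2 * Real.pi) * (E * Real.exp (2 * |z.im|))) * Real.exp (1 ^ 2 - z.im ^ 2) := by
          gcongr
          refine (norm_Gamma_three_halves_le _).trans ?_
          gcongr
          exact hE' _
      _ = 2 * √(2 * Real.pi) * |t| * E * Real.exp (|z.im| + 2 * |z.im| + (1 ^ 2 - z.im ^ 2)) := by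
          rw [Real.exp_add, Real.exp_add]; ring
      _ ≤ 2 * √(2 * Real.pi) * |t| * E * Real.exp 4 := by
          gcongr
          nlinarith [sq_nonneg (|z.im| - 3 / 2), sq_abs z.im]
      _ = C * |t| * E := by rw [hC]; ring
  have hmain := norm_le_interp_of_mem_verticalClosedStrip₀₁' f (z := (θ : ℂ))
    (show (θ : ℂ) ∈ verticalClosedStrip 0 1 from ⟨by simpa using h0, by simpa using h1⟩) hd hB ha hb
  have hint : (C * E) ^ (1 - (θ : ℂ).re) * (C * |t| * E) ^ (θ : ℂ).re = C * |t| ^ θ * E := by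
    rw [Complex.ofReal_re, show C * |t| * E = (C * E) * |t| by ring,
      Real.mul_rpow (mul_nonneg hCpos.le hEpos.le) (abs_nonneg t), ← mul_assoc,
      ← Real.rpow_add (by positivity)]
    simp; ring
  rw [hint] at hmain
  refine le_trans ?_ hmain
  simp only [f, norm_mul, hnormexp]
  have h7 : (1 : ℝ) ≤ Real.exp ((θ : ℂ).re ^ 2 - (θ : ℂ).im ^ 2) := by
    rw [Real.one_le_exp_iff]; simp; positivity
  have h8 : (((1 / 2 + θ : ℝ) : ℂ) + t * I) = 1 / 2 + (θ : ℂ) + t * I := by push_cast; ring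
  rw [h8]
  exact le_mul_of_one_le_right (norm_nonneg _) h7

/-- The size of the Gamma function on the vertical line through a point of real part `x`, at
height `t`, up to a constant factor. -/
noncomputable def gammaScale (x t : ℝ) : ℝ := |t| ^ (x - 1 / 2) * Real.exp (-(Real.pi / 2 * |t|))


lemma eventually_cocompact_le_abs (r : ℝ) : ∀ᶠ t : ℝ in cocompact ℝ, r ≤ |t| := by
  have := tendsto_norm_cocompact_atTop (E := ℝ)
  exact this.eventually_ge_atTop r

lemma isTheta_add_mul_I (x : ℂ) :
    (fun t : ℝ => x + t * I) =Θ[cocompact ℝ] fun t : ℝ => |t| := by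
  have ho : (fun _ : ℝ => x) =o[cocompact ℝ] fun t : ℝ => (t * I : ℂ) := by
    refine isLittleO_const_left.2 (Or.inr ?_)
    have := tendsto_norm_cocompact_atTop (E := ℝ)
    refine this.congr fun t => by simp
  have h1 : (fun t : ℝ => x + t * I) =Θ[cocompact ℝ] fun t : ℝ => (t * I : ℂ) := by
    have := ho.add_isTheta (isTheta_refl (fun t : ℝ => (t * I : ℂ)) _)
    exact this
  refine h1.trans ?_
  refine ⟨IsBigO.of_bound 1 (Eventually.of_forall fun t => by simp),
    IsBigO.of_bound 1 (Eventually.of_forall fun t => by simp)⟩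

lemma gammaScale_add_one {x t : ℝ} (ht : 1 ≤ |t|) :
    gammaScale (x + 1) t = |t| * gammaScale x t := by
  have : 0 < |t| := by linarith
  rw [gammaScale, gammaScale, show x + 1 - 1 / 2 = 1 + (x - 1 / 2) by ring, Real.rpow_add this,
    Real.rpow_one]
  ring

/-- The functional equation multiplies Γ by a factor of size |t|, and the scale changes by exactly
|t|. Having both directions allows induction over all integers from the strip 1/2 ≤ Re ≤ 3/2. -/
lemma isBigO_Gamma_step (x : ℝ) :
    ((fun t : ℝ => Gamma (x + t * I)) =O[cocompact ℝ] gammaScale x) ↔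
    ((fun t : ℝ => Gamma ((x + 1 : ℝ) + t * I)) =O[cocompact ℝ] gammaScale (x + 1)) := by
  have h1 : (fun t : ℝ => Gamma ((x + 1 : ℝ) + t * I)) =ᶠ[cocompact ℝ]
      fun t : ℝ => (x + t * I) * Gamma (x + t * I) := by
    filter_upwards [eventually_cocompact_le_abs 1] with t ht
    rw [← Complex.Gamma_add_one]
    · congr 1; push_cast; ring
    · intro h
      have := congrArg Complex.im h
      simp at this
      simp [this] at ht
      linarith
  have h2 : gammaScale (x + 1) =ᶠ[cocompact ℝ] fun t => |t| * gammaScale x t := by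
    filter_upwards [eventually_cocompact_le_abs 1] with t ht
    exact gammaScale_add_one ht
  have h3 := isTheta_add_mul_I (x : ℂ)
  constructor
  · intro h
    exact h1.trans_isBigO ((h3.1.mul h).trans_eventuallyEq h2.symm)
  · intro h
    have h4 : (fun t : ℝ => (x + t * I) * Gamma (x + t * I)) =O[cocompact ℝ]
      fun t => |t| * gammaScale x t := (h1.symm.trans_isBigO h).trans_eventuallyEq h2
    have h5 := (h3.inv.1).mul h4
    refine (EventuallyEq.trans_isBigO ?_ h5).trans_eventuallyEq ?_
    · filter_upwards [eventually_cocompact_le_abs 1] with t ht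
      rw [inv_mul_cancel_left₀]
      intro h
      have := congrArg Complex.im h
      simp at this
      simp [this] at ht
      linarith
    · filter_upwards [eventually_cocompact_le_abs 1] with t ht
      rw [inv_mul_cancel_left₀]
      linarith

lemma isBigO_Gamma_vertical_ofReal (x : ℝ) :
    (fun t : ℝ => Gamma (x + t * I)) =O[cocompact ℝ] gammaScale x := by
  have key : ∀ n : ℤ, ∀ θ : ℝ, 0 ≤ θ → θ ≤ 1 →
      (fun t : ℝ => Gamma ((1 / 2 + θ + n : ℝ) + t * I)) =O[cocompact ℝ]
        gammaScale (1 / 2 + θ + n) := by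
    intro n θ h0 h1
    induction n using Int.induction_on with
    | zero =>
      obtain ⟨C, -, hC⟩ := exists_norm_Gamma_strip_le
      refine IsBigO.of_bound C ?_
      filter_upwards [eventually_cocompact_le_abs 1] with t ht
      have := hC θ t h0 h1 ht
      simp only [Int.cast_zero, add_zero]
      refine this.trans (le_of_eq ?_)
      rw [gammaScale, Real.norm_of_nonneg (by positivity)]
      ring_nf
    | succ i ih =>
      have := (isBigO_Gamma_step _).1 ih
      push_cast at this ⊢
      simpa [add_assoc] using this
    | pred i ih =>
      refine (isBigO_Gamma_step _).2 ?_
      have h : (1 / 2 + θ + ((-(i : ℤ) - 1 : ℤ) : ℝ)) + 1 = 1 / 2 + θ + ((-(i : ℤ) : ℤ) : ℝ) := by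
        push_cast; ring
      rw [h]
      exact ih
  have := key ⌊x - 1 / 2⌋ (Int.fract (x - 1 / 2)) (Int.fract_nonneg _) (Int.fract_lt_one _).le
  rwa [show 1 / 2 + Int.fract (x - 1 / 2) + ⌊x - 1 / 2⌋ = x by
    rw [add_assoc, Int.fract_add_floor]; ring] at this

lemma gammaScale_neg (x t : ℝ) : gammaScale x (-t) = gammaScale x t := by
  simp [gammaScale]

lemma gammaScale_mul_reflect {x t : ℝ} (ht : 1 ≤ |t|) :
    gammaScale x t * gammaScale (1 - x) t = Real.exp (-(Real.pi * |t|)) := by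
  have h0 : 0 < |t| := by linarith
  rw [gammaScale, gammaScale, mul_mul_mul_comm, ← Real.rpow_add h0, ← Real.exp_add]
  rw [show x - 1 / 2 + (1 - x - 1 / 2) = 0 by ring, Real.rpow_zero, one_mul]
  congr 1; ring

lemma gammaScale_pos {x t : ℝ} (ht : 1 ≤ |t|) : 0 < gammaScale x t := by
  have h0 : 0 < |t| := by linarith
  unfold gammaScale; positivity

/-- The lower bound follows from the upper one on the reflected line: Γ(z)Γ(1-z) = π / sin(πz), the
sine is at most exp(π|t|), and the scales at x and 1 - x multiply to exp(-π|t|). -/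
lemma isBigO_gammaScale_Gamma (x : ℝ) :
    gammaScale x =O[cocompact ℝ] (fun t : ℝ => Gamma (x + t * I)) := by
  have h1 := (isBigO_Gamma_vertical_ofReal (1 - x)).comp_tendsto
    (Homeomorph.neg ℝ).isClosedEmbedding.tendsto_cocompact
  obtain ⟨C, hCpos, hC⟩ := h1.exists_pos
  refine IsBigO.of_bound (C / Real.pi) ?_
  filter_upwards [hC.bound, eventually_cocompact_le_abs 1] with t ht h1t
  simp only [Function.comp, Homeomorph.coe_neg, gammaScale_neg] at ht
  have hg := gammaScale_pos (x := x) h1t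
  have hg' := gammaScale_pos (x := 1 - x) h1t
  rw [Real.norm_of_nonneg hg'.le] at ht
  rw [Real.norm_of_nonneg hg.le]
  have hr := congrArg norm (Complex.Gamma_mul_Gamma_one_sub (x + t * I))
  rw [norm_mul, norm_div, show (1 - (x + t * I) : ℂ) = (1 - x : ℝ) + (-t : ℝ) * I by
    push_cast; ring, Complex.norm_real, Real.norm_of_nonneg Real.pi_pos.le] at hr
  have hs : ‖Complex.sin (Real.pi * (x + t * I))‖ ≤ Real.exp (Real.pi * |t|) := by
    rw [Complex.sin, norm_div, norm_mul, norm_I, mul_one]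
    have e1 : ‖Complex.exp (-(Real.pi * (x + t * I)) * I)‖ ≤ Real.exp (Real.pi * |t|) := by
      rw [Complex.norm_exp, Real.exp_le_exp]
      simp
      nlinarith [le_abs_self t, Real.pi_pos]
    have e2 : ‖Complex.exp ((Real.pi * (x + t * I)) * I)‖ ≤ Real.exp (Real.pi * |t|) := by
      rw [Complex.norm_exp, Real.exp_le_exp]
      simp
      nlinarith [neg_abs_le t, Real.pi_pos]
    have := norm_sub_le (Complex.exp (-(Real.pi * (x + t * I)) * I))
      (Complex.exp ((Real.pi * (x + t * I)) * I))
    simp only [Complex.norm_ofNat]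
    linarith
  have hsne : 0 < ‖Complex.sin (Real.pi * (x + t * I))‖ := by
    rw [norm_pos_iff]
    intro h0
    rw [Complex.sin_eq_zero_iff] at h0
    obtain ⟨k, hk⟩ := h0
    have h9 := congrArg Complex.im hk
    simp [Real.pi_ne_zero] at h9
    simp [h9] at h1t
    linarith
  rw [eq_div_iff hsne.ne'] at hr
  have hE : Real.exp (Real.pi * |t|) * (gammaScale x t * gammaScale (1 - x) t) = 1 := by
    rw [gammaScale_mul_reflect h1t, ← Real.exp_add]; simp
  have hEp := Real.exp_pos (Real.pi * |t|)
  set A := ‖Gamma (x + t * I)‖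
  set B := ‖Gamma ((1 - x : ℝ) + (-t : ℝ) * I)‖
  have h10 : Real.pi ≤ A * (C * gammaScale (1 - x) t) * Real.exp (Real.pi * |t|) := by
    refine hr.symm.le.trans ?_
    gcongr
  rw [div_mul_eq_mul_div, le_div_iff₀ Real.pi_pos]
  calc gammaScale x t * Real.pi
      ≤ gammaScale x t * (A * (C * gammaScale (1 - x) t) * Real.exp (Real.pi * |t|)) := by gcongr
    _ = C * A * (Real.exp (Real.pi * |t|) * (gammaScale x t * gammaScale (1 - x) t)) := by ring
    _ = C * A := by rw [hE, mul_one]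

/-- This absorbs the imaginary part of a complex parameter, which only shifts the height. -/
lemma isTheta_gammaScale_add (x h : ℝ) :
    (fun t => gammaScale x (t + h)) =Θ[cocompact ℝ] gammaScale x := by
  have h1 : (fun t : ℝ => |t + h|) =Θ[cocompact ℝ] fun t : ℝ => |t| := by
    have ho : (fun _ : ℝ => h) =o[cocompact ℝ] fun t : ℝ => t :=
      isLittleO_const_left.2 (Or.inr (tendsto_norm_cocompact_atTop (E := ℝ)))
    have := (isTheta_refl (fun t : ℝ => t) (cocompact ℝ)).add_isLittleO ho
    exact (isTheta_norm_left.2 (isTheta_norm_right.2 this))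
  have h2 := h1.rpow (r := x - 1 / 2)
    (Eventually.of_forall fun t => abs_nonneg _) (Eventually.of_forall fun t => abs_nonneg _)
  refine h2.mul ⟨IsBigO.of_bound (Real.exp (Real.pi / 2 * |h|)) ?_,
    IsBigO.of_bound (Real.exp (Real.pi / 2 * |h|)) ?_⟩
  · refine Eventually.of_forall fun t => ?_
    rw [Real.norm_of_nonneg (Real.exp_pos _).le, Real.norm_of_nonneg (Real.exp_pos _).le,
      ← Real.exp_add, Real.exp_le_exp]
    have : |t| ≤ |t + h| + |h| := by simpa using abs_sub (t + h) h
    nlinarith [Real.pi_pos]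
  · refine Eventually.of_forall fun t => ?_
    rw [Real.norm_of_nonneg (Real.exp_pos _).le, Real.norm_of_nonneg (Real.exp_pos _).le,
      ← Real.exp_add, Real.exp_le_exp]
    have := abs_add_le t h
    nlinarith [Real.pi_pos]

/-- The size of the Gamma function on vertical lines. -/
lemma isTheta_Gamma_vertical (z : ℂ) :
    (fun t : ℝ => Gamma (z + t * I)) =Θ[cocompact ℝ] gammaScale z.re := by
  have h : (fun t : ℝ => Gamma (z.re + t * I)) =Θ[cocompact ℝ] gammaScale z.re :=
    ⟨isBigO_Gamma_vertical_ofReal _, isBigO_gammaScale_Gamma _⟩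
  have ht := (Homeomorph.addRight z.im).isClosedEmbedding.tendsto_cocompact
  have h1 : (fun t : ℝ => Gamma (z.re + (t + z.im : ℝ) * I)) =Θ[cocompact ℝ]
      fun t => gammaScale z.re (t + z.im) :=
    ⟨h.1.comp_tendsto ht, h.2.comp_tendsto ht⟩
  refine IsTheta.trans (EventuallyEq.isTheta (Eventually.of_forall fun t => ?_))
    (h1.trans (isTheta_gammaScale_add _ _))
  dsimp only
  congr 1
  apply Complex.ext <;> simp; ring

lemma isTheta_Gamma_vertical_sub (z : ℂ) :
    (fun t : ℝ => Gamma (z - t * I)) =Θ[cocompact ℝ] gammaScale z.re := by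
  have ht := (Homeomorph.neg ℝ).isClosedEmbedding.tendsto_cocompact
  have h := isTheta_Gamma_vertical z
  have h1 : (fun t : ℝ => Gamma (z + (-t : ℝ) * I)) =Θ[cocompact ℝ]
      fun t => gammaScale z.re (-t) :=
    ⟨h.1.comp_tendsto ht, h.2.comp_tendsto ht⟩
  simpa [gammaScale_neg, sub_eq_add_neg] using h1

/-! ### Absolute convergence of the Mellin-Barnes integrals. -/

lemma integrable_of_continuous_of_isBigO_rpow {f : ℝ → ℂ} (hf : Continuous f) {r : ℝ} (hr : 1 < r)
    (ho : f =O[cocompact ℝ] fun t : ℝ => |t| ^ (-r)) : Integrable f := by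
  have hg : Integrable (fun t : ℝ => (1 + ‖t‖) ^ (-r)) :=
    integrable_one_add_norm (by simpa using hr)
  refine hf.locallyIntegrable.integrable_of_isBigO_cocompact (ho.trans ?_)
    (hg.integrableAtFilter _)
  refine IsBigO.of_bound (2 ^ r) ?_
  filter_upwards [eventually_cocompact_le_abs 1] with t ht
  have h0 : 0 < |t| := by linarith
  rw [Real.norm_of_nonneg (by positivity), Real.norm_of_nonneg (by positivity), Real.norm_eq_abs,
    Real.rpow_neg (by positivity), Real.rpow_neg (by positivity), ← div_eq_mul_inv,
    ← Real.div_rpow (by positivity) (by positivity), ← Real.inv_rpow (by positivity)]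
  gcongr
  rw [inv_eq_one_div, div_le_div_iff₀ h0 (by positivity)]
  linarith

lemma isBigO_rpow_mul_exp_neg (y : ℝ) {a : ℝ} (ha : 0 < a) :
    (fun t : ℝ => |t| ^ y * Real.exp (-(a * |t|))) =O[cocompact ℝ] fun t : ℝ => |t| ^ (-2 : ℝ) := by
  have h1 := ((isLittleO_exp_neg_mul_rpow_atTop ha (-2 - y)).isBigO).comp_tendsto
    (tendsto_norm_cocompact_atTop (E := ℝ))
  have h2 := (isBigO_refl (fun t : ℝ => |t| ^ y) (cocompact ℝ)).mul h1
  refine (h2.congr_left fun t => ?_).trans_eventuallyEq ?_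
  · simp
  · filter_upwards [eventually_cocompact_le_abs 1] with t ht
    have h0 : 0 < |t| := by linarith
    simp only [Function.comp, Real.norm_eq_abs]
    rw [← Real.rpow_add h0]; congr 1; ring

lemma continuous_Gamma_vertical {z : ℂ} (hz : 0 < z.re) :
    Continuous fun t : ℝ => Gamma (z + t * I) := by
  rw [continuous_iff_continuousAt]
  intro t
  refine ContinuousAt.comp (g := Gamma) (Complex.differentiableAt_Gamma _ ?_).continuousAt
    (by fun_prop)
  intro m h
  have := congrArg Complex.re h
  simp at this
  have hm : (0 : ℝ) ≤ m := m.cast_nonneg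
  linarith

lemma continuous_Gamma_vertical_sub {z : ℂ} (hz : 0 < z.re) :
    Continuous fun t : ℝ => Gamma (z - t * I) := by
  have := (continuous_Gamma_vertical hz).comp (continuous_neg (G := ℝ))
  simpa [Function.comp_def, sub_eq_add_neg] using this

lemma continuous_inv_Gamma {X : Type*} [TopologicalSpace X] {f : X → ℂ} (hf : Continuous f) :
    Continuous fun x => (Gamma (f x))⁻¹ :=
  Complex.differentiable_one_div_Gamma.continuous.comp hf

/-- The quotient of Gamma functions in a Mellin-Barnes integral of Gauss type. -/
noncomputable def gammaQuotient (p q b c v : ℂ) : ℂ :=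
  Gamma (p + v) * Gamma (q - v) * ((Gamma (b + v))⁻¹ * (Gamma (c - v))⁻¹)

lemma add_vertical (z : ℂ) (σ t : ℝ) : z + (σ + t * I) = (z + σ) + t * I := by ring

lemma sub_vertical (z : ℂ) (σ t : ℝ) : z - (σ + t * I) = (z - σ) - t * I := by ring

/-- Two Gammas above and two below: the exponentials cancel and |t|^(-Re(b+c-p-q)) is left. The
conditions on σ keep the line away from the poles of the numerator, while reciprocal Gammas are
entire. -/
lemma verticalIntegrable_gammaQuotient {p q b c : ℂ} {σ : ℝ} (hp : 0 < p.re + σ)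
    (hq : 0 < q.re - σ) (hS : 1 < (b + c - p - q).re) :
    VerticalIntegrable (gammaQuotient p q b c) σ := by
  unfold VerticalIntegrable gammaQuotient
  simp only [add_vertical, sub_vertical]
  refine integrable_of_continuous_of_isBigO_rpow ?_ hS ?_
  · refine ((continuous_Gamma_vertical (by simpa using hp)).mul
      (continuous_Gamma_vertical_sub (by simpa using hq))).mul
      ((continuous_inv_Gamma (by fun_prop)).mul (continuous_inv_Gamma (by fun_prop)))
  · have h := (((isTheta_Gamma_vertical (p + σ)).1.mul (isTheta_Gamma_vertical_sub (q - σ)).1).mul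
      ((isTheta_Gamma_vertical (b + σ)).inv.1.mul (isTheta_Gamma_vertical_sub (c - σ)).inv.1))
    refine h.trans_eventuallyEq ?_
    filter_upwards [eventually_cocompact_le_abs 1] with t ht
    have h0 : 0 < |t| := by linarith
    simp only [gammaScale]
    have hE := (Real.exp_pos (-(Real.pi / 2 * |t|))).ne'
    rw [mul_inv, mul_inv, ← Real.rpow_neg h0.le, ← Real.rpow_neg h0.le]
    rw [show -(b + c - p - q).re = ((p + σ).re - 1 / 2) + ((q - σ).re - 1 / 2)
      + -((b + σ).re - 1 / 2) + -((c - σ).re - 1 / 2) by simp; ring,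
      Real.rpow_add h0, Real.rpow_add h0, Real.rpow_add h0]
    field_simp

lemma verticalIntegrable_Gamma_div_Gamma {p b : ℂ} {σ : ℝ} (hp : 0 < p.re + σ)
    (hS : 1 < (b - p).re) :
    VerticalIntegrable (fun v => Gamma (p + v) / Gamma (b + v)) σ := by
  unfold VerticalIntegrable
  simp only [add_vertical, div_eq_mul_inv]
  refine integrable_of_continuous_of_isBigO_rpow ?_ hS ?_
  · exact (continuous_Gamma_vertical (by simpa using hp)).mul (continuous_inv_Gamma (by fun_prop))
  · have h := (isTheta_Gamma_vertical (p + σ)).1.mul (isTheta_Gamma_vertical (b + σ)).inv.1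
    refine h.trans_eventuallyEq ?_
    filter_upwards [eventually_cocompact_le_abs 1] with t ht
    have h0 : 0 < |t| := by linarith
    simp only [gammaScale]
    have hE := (Real.exp_pos (-(Real.pi / 2 * |t|))).ne'
    rw [mul_inv, ← Real.rpow_neg h0.le]
    rw [show -(b - p).re = ((p + σ).re - 1 / 2) + -((b + σ).re - 1 / 2) by simp,
      Real.rpow_add h0]
    field_simp

lemma verticalIntegrable_Gamma_mul_Gamma {p q : ℂ} {σ : ℝ} (hp : 0 < p.re + σ)
    (hq : 0 < q.re - σ) :
    VerticalIntegrable (fun v => Gamma (p + v) * Gamma (q - v)) σ := by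
  unfold VerticalIntegrable
  simp only [add_vertical, sub_vertical]
  refine integrable_of_continuous_of_isBigO_rpow ?_ (one_lt_two) (IsBigO.trans ?_
    (isBigO_rpow_mul_exp_neg ((p + σ).re - 1 / 2 + ((q - σ).re - 1 / 2)) Real.pi_pos))
  · exact (continuous_Gamma_vertical (by simpa using hp)).mul
      (continuous_Gamma_vertical_sub (by simpa using hq))
  · refine ((isTheta_Gamma_vertical (p + σ)).1.mul
      (isTheta_Gamma_vertical_sub (q - σ)).1).trans_eventuallyEq ?_
    filter_upwards [eventually_cocompact_le_abs 1] with t ht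
    have h0 : 0 < |t| := by linarith
    simp only [gammaScale]
    rw [Real.rpow_add h0, show -(Real.pi * |t|) = -(Real.pi / 2 * |t|) + -(Real.pi / 2 * |t|) by
      ring, Real.exp_add]
    ring

/-- Three Gammas against one leave a net decay exp(-π|t|), so no condition on c is needed. -/
lemma verticalIntegrable_barnes_three {a b u c : ℂ} {σ : ℝ} (ha : 0 < a.re + σ)
    (hb : 0 < b.re + σ) (hu : 0 < u.re - σ) :
    VerticalIntegrable (fun v => Gamma (a + v) * Gamma (b + v) * Gamma (u - v) / Gamma (c + v))
      σ := by
  unfold VerticalIntegrable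
  simp only [add_vertical, sub_vertical, div_eq_mul_inv]
  refine integrable_of_continuous_of_isBigO_rpow ?_ (one_lt_two) (IsBigO.trans ?_
    (isBigO_rpow_mul_exp_neg ((a + σ).re - 1 / 2 + ((b + σ).re - 1 / 2) +
      ((u - σ).re - 1 / 2) + -((c + σ).re - 1 / 2)) Real.pi_pos))
  · exact (((continuous_Gamma_vertical (by simpa using ha)).mul
      (continuous_Gamma_vertical (by simpa using hb))).mul
      (continuous_Gamma_vertical_sub (by simpa using hu))).mul (continuous_inv_Gamma (by fun_prop))
  · refine ((((isTheta_Gamma_vertical (a + σ)).1.mul (isTheta_Gamma_vertical (b + σ)).1).mul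
      (isTheta_Gamma_vertical_sub (u - σ)).1).mul
      (isTheta_Gamma_vertical (c + σ)).inv.1).trans_eventuallyEq ?_
    filter_upwards [eventually_cocompact_le_abs 1] with t ht
    have h0 : 0 < |t| := by linarith
    simp only [gammaScale]
    have hE := (Real.exp_pos (-(Real.pi / 2 * |t|))).ne'
    rw [mul_inv, ← Real.rpow_neg h0.le, Real.rpow_add h0, Real.rpow_add h0, Real.rpow_add h0,
      show -(Real.pi * |t|) = -(Real.pi / 2 * |t|) + -(Real.pi / 2 * |t|) by ring, Real.exp_add]
    field_simp

lemma verticalIntegrable_barnes_four {a b p q : ℂ} {σ : ℝ} (ha : 0 < a.re + σ)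
    (hb : 0 < b.re + σ) (hp : 0 < p.re - σ) (hq : 0 < q.re - σ) :
    VerticalIntegrable (fun v => Gamma (a + v) * Gamma (b + v) * Gamma (p - v) * Gamma (q - v))
      σ := by
  unfold VerticalIntegrable
  simp only [add_vertical, sub_vertical]
  refine integrable_of_continuous_of_isBigO_rpow ?_ (one_lt_two) (IsBigO.trans ?_
    (isBigO_rpow_mul_exp_neg ((a + σ).re - 1 / 2 + ((b + σ).re - 1 / 2) +
      ((p - σ).re - 1 / 2) + ((q - σ).re - 1 / 2)) Real.two_pi_pos))
  · exact (((continuous_Gamma_vertical (by simpa using ha)).mul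
      (continuous_Gamma_vertical (by simpa using hb))).mul
      (continuous_Gamma_vertical_sub (by simpa using hp))).mul
      (continuous_Gamma_vertical_sub (by simpa using hq))
  · refine ((((isTheta_Gamma_vertical (a + σ)).1.mul (isTheta_Gamma_vertical (b + σ)).1).mul
      (isTheta_Gamma_vertical_sub (p - σ)).1).mul
      (isTheta_Gamma_vertical_sub (q - σ)).1).trans_eventuallyEq ?_
    filter_upwards [eventually_cocompact_le_abs 1] with t ht
    have h0 : 0 < |t| := by linarith
    simp only [gammaScale]
    rw [Real.rpow_add h0, Real.rpow_add h0, Real.rpow_add h0,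
      show -(2 * Real.pi * |t|) = -(Real.pi / 2 * |t|) + -(Real.pi / 2 * |t|)
        + -(Real.pi / 2 * |t|) + -(Real.pi / 2 * |t|) by ring, Real.exp_add, Real.exp_add,
      Real.exp_add]
    ring

/-! ### The binomial series, the regularized hypergeometric series and Euler's integral. -/

lemma hasSum_one_sub_cpow_neg (A : ℂ) {z : ℂ} (hz : ‖z‖ < 1) :
    HasSum (fun n : ℕ => (ascPochhammer ℂ n).eval A / n.factorial * z ^ n) ((1 - z) ^ (-A)) := by
  have h := (Complex.one_div_one_sub_cpow_hasFPowerSeriesOnBall_zero A).hasSum (y := z)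
    (by simpa [enorm_eq_nnnorm, ← NNReal.coe_lt_coe] using hz)
  simp only [FormalMultilinearSeries.ofScalars_apply_eq, zero_add, smul_eq_mul] at h
  rw [Complex.cpow_neg, ← one_div]
  refine h.congr_fun fun n => ?_
  congr 1
  rw [← Ring.multichoose_eq, div_eq_iff (by exact_mod_cast n.factorial_ne_zero), mul_comm,
    ← nsmul_eq_mul, Ring.factorial_nsmul_multichoose_eq_ascPochhammer,
    ← Polynomial.ascPochhammer_smeval_eq_eval, Polynomial.ascPochhammer_smeval_cast]

lemma regularizedGaussHGFun_eq_tsum (a b c z : ℂ) :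
    regularizedGaussHGFun a b c z = ∑' n : ℕ, (ascPochhammer ℂ n).eval a *
      (ascPochhammer ℂ n).eval b / (n.factorial * Gamma (c + n)) * z ^ n := by
  rw [regularizedGaussHGFun, FormalMultilinearSeries.sum]
  refine tsum_congr fun n => ?_
  rw [FormalMultilinearSeries.apply_eq_pow_smul_coeff, coeff_regularizedGaussHGFunSeries,
    smul_eq_mul, mul_comm]

lemma summable_norm_regularizedGaussHG (a b c : ℂ) {z : ℂ} (hz : ‖z‖ < 1) :
    Summable fun n : ℕ => ‖(ascPochhammer ℂ n).eval a *
      (ascPochhammer ℂ n).eval b / (n.factorial * Gamma (c + n)) * z ^ n‖ := by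
  have h := (regularizedGaussHGFunSeries a b c).summable_norm_apply (x := z) (by
    refine Metric.eball_subset_eball (radius_regularizedGaussHGFunSeries_ge_one a b c) ?_
    simpa [enorm_eq_nnnorm, ← NNReal.coe_lt_coe] using hz)
  refine h.congr fun n => ?_
  rw [FormalMultilinearSeries.apply_eq_pow_smul_coeff, coeff_regularizedGaussHGFunSeries,
    smul_eq_mul, mul_comm]

lemma hasSum_regularizedGaussHGFun (a b c : ℂ) {z : ℂ} (hz : ‖z‖ < 1) :
    HasSum (fun n : ℕ => (ascPochhammer ℂ n).eval a *
      (ascPochhammer ℂ n).eval b / (n.factorial * Gamma (c + n)) * z ^ n)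
      (regularizedGaussHGFun a b c z) := by
  rw [regularizedGaussHGFun_eq_tsum]
  exact (summable_norm_regularizedGaussHG a b c hz).of_norm.hasSum

lemma ne_neg_nat_of_re_pos {z : ℂ} (hz : 0 < z.re) (m : ℕ) : z ≠ -(m : ℂ) := by
  intro h
  have := congrArg Complex.re h
  simp at this
  have hm : (0 : ℝ) ≤ m := m.cast_nonneg
  linarith

lemma ascPochhammer_eval_eq_Gamma_div {z : ℂ} (hz : ∀ m : ℕ, z ≠ -(m : ℂ)) (n : ℕ) :
    (ascPochhammer ℂ n).eval z * Gamma z = Gamma (z + n) := by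
  rw [← Complex.Gamma_add_nat_div_Gamma_eq z hz, div_mul_cancel₀ _ (Complex.Gamma_ne_zero hz)]

/-- **Euler's integral** for the Gauss hypergeometric function. -/
lemma integral_euler {A B C : ℂ} (hB : 0 < B.re) (hCB : 0 < (C - B).re) {x : ℝ} (hx0 : 0 ≤ x)
    (hx : x < 1) :
    ∫ r in (0 : ℝ)..1, (r : ℂ) ^ (B - 1) * (1 - r : ℂ) ^ (C - B - 1) * (1 - r * x : ℂ) ^ (-A)
      = Gamma B * Gamma (C - B) * regularizedGaussHGFun A B C x := by
  set g : ℝ → ℂ := fun r => (r : ℂ) ^ (B - 1) * (1 - r : ℂ) ^ (C - B - 1) with hg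
  have hgi : IntervalIntegrable g volume 0 1 := Complex.betaIntegral_convergent hB hCB
  set co : ℕ → ℂ := fun n => (ascPochhammer ℂ n).eval A / n.factorial * x ^ n with hco
  have hxn : ‖(x : ℂ)‖ < 1 := by rw [Complex.norm_real, Real.norm_of_nonneg hx0]; exact hx
  have hcosum : Summable fun n => ‖co n‖ := (hasSum_one_sub_cpow_neg A hxn).summable.norm
  have hterm : ∀ n : ℕ, ∫ r in (0 : ℝ)..1, co n * (g r * (r : ℂ) ^ n)
      = Gamma B * Gamma (C - B) * ((ascPochhammer ℂ n).eval A *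
      (ascPochhammer ℂ n).eval B / (n.factorial * Gamma (C + n)) * (x : ℂ) ^ n) := by
    intro n
    rw [intervalIntegral.integral_const_mul]
    have h1 : ∫ r in (0 : ℝ)..1, g r * (r : ℂ) ^ n = betaIntegral (B + n) (C - B) := by
      rw [betaIntegral]
      rw [intervalIntegral.integral_of_le zero_le_one, intervalIntegral.integral_of_le zero_le_one]
      refine setIntegral_congr_fun measurableSet_Ioc fun r hr => ?_
      have hr0 : (r : ℂ) ≠ 0 := Complex.ofReal_ne_zero.2 hr.1.ne'
      simp only [hg]
      rw [show B + n - 1 = (B - 1) + n by ring, Complex.cpow_add _ _ hr0, Complex.cpow_natCast]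
      ring
    have hBn : 0 < (B + n).re := by simp; positivity
    rw [h1, Complex.betaIntegral_eq_Gamma_mul_div _ _ hBn hCB,
      ← ascPochhammer_eval_eq_Gamma_div (ne_neg_nat_of_re_pos hB),
      show B + n + (C - B) = C + n by ring]
    simp only [hco]
    field_simp
  -- The power (1 - rx)^(-A) is expanded by the binomial series and integrated term by term against
  -- the Beta density g. Since 0 < r ≤ 1, the n-th term is dominated by ‖co n‖ ‖g r‖.
  have hs := intervalIntegral.hasSum_integral_of_dominated_convergence (μ := volume) (a := 0)
    (b := 1) (F := fun n (r : ℝ) => co n * (g r * (r : ℂ) ^ n))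
    (f := fun r : ℝ => g r * (1 - r * x : ℂ) ^ (-A))
    (fun n r => ‖co n‖ * ‖g r‖) ?_ ?_ ?_ ?_ ?_
  · rw [← hs.tsum_eq]
    simp_rw [hterm]
    rw [tsum_mul_left, regularizedGaussHGFun_eq_tsum]
  · intro n
    have h1 : AEStronglyMeasurable g (volume.restrict (Set.uIoc 0 1)) :=
      hgi.aestronglyMeasurable_restrict_uIoc
    exact (h1.mul (by fun_prop)).const_mul _
  · intro n
    refine Eventually.of_forall fun r hr => ?_
    rw [Set.uIoc_of_le zero_le_one] at hr
    rw [norm_mul, norm_mul (g r), norm_pow _ n, Complex.norm_real, Real.norm_of_nonneg hr.1.le]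
    gcongr
    exact mul_le_of_le_one_right (norm_nonneg _) (pow_le_one₀ hr.1.le hr.2)
  · exact Eventually.of_forall fun r _ => hcosum.mul_right _
  · simp_rw [tsum_mul_right]
    exact hgi.norm.const_mul _
  · refine Eventually.of_forall fun r hr => ?_
    rw [Set.uIoc_of_le zero_le_one] at hr
    have hz : ‖((r * x : ℝ) : ℂ)‖ < 1 := by
      rw [Complex.norm_real, Real.norm_of_nonneg (mul_nonneg hr.1.le hx0)]
      nlinarith [hr.1, hr.2]
    have := (hasSum_one_sub_cpow_neg A hz).mul_left (g r)
    push_cast at this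
    refine this.congr_fun ?_
    intro n
    simp only [hco, mul_pow]
    ring

/-! ### Beta integrals on (0,1) and on (0,∞). -/

/-- Identities between complex powers of positive reals are reduced through this to linear
identities between real logarithms, with no branch questions. -/
lemma ofReal_cpow_eq_exp {a : ℝ} (ha : 0 < a) (z : ℂ) :
    (a : ℂ) ^ z = Complex.exp ((Real.log a : ℂ) * z) := by
  rw [Complex.cpow_def_of_ne_zero (Complex.ofReal_ne_zero.2 ha.ne'), Complex.ofReal_log ha.le]

lemma image_div_one_sub_Ioo : (fun r : ℝ => r / (1 - r)) '' Set.Ioo 0 1 = Set.Ioi 0 := by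
  ext w
  constructor
  · rintro ⟨r, hr, rfl⟩
    exact div_pos hr.1 (by linarith [hr.2])
  · intro hw
    have hw0 : 0 < w := hw
    refine ⟨w / (1 + w), ⟨by positivity, by rw [div_lt_one (by positivity)]; linarith⟩, ?_⟩
    field_simp
    ring

lemma hasDerivAt_div_one_sub {r : ℝ} (hr : r < 1) :
    HasDerivAt (fun r : ℝ => r / (1 - r)) (((1 - r) ^ 2)⁻¹) r := by
  have h : (1 - r) ≠ 0 := by linarith
  have := (hasDerivAt_id r).div ((hasDerivAt_const r (1 : ℝ)).sub (hasDerivAt_id r)) h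
  refine this.congr_deriv ?_
  simp

lemma injOn_div_one_sub : Set.InjOn (fun r : ℝ => r / (1 - r)) (Set.Ioo 0 1) := by
  intro a ha b hb h
  have h1 : (1 - a) ≠ 0 := by linarith [ha.2]
  have h2 : (1 - b) ≠ 0 := by linarith [hb.2]
  simp only at h
  rw [div_eq_div_iff h1 h2] at h
  linarith

lemma integral_Ioi_eq_integral_Ioo (g : ℝ → ℂ) :
    ∫ x in Set.Ioi (0 : ℝ), g x
      = ∫ r in Set.Ioo (0 : ℝ) 1, ((1 - r) ^ 2)⁻¹ • g (r / (1 - r)) := by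
  rw [← image_div_one_sub_Ioo, integral_image_eq_integral_abs_deriv_smul measurableSet_Ioo
    (fun r hr => (hasDerivAt_div_one_sub hr.2).hasDerivWithinAt) injOn_div_one_sub]
  refine setIntegral_congr_fun measurableSet_Ioo fun r _ => ?_
  simp only [abs_of_nonneg (inv_nonneg.2 (sq_nonneg (1 - r)))]

lemma integrableOn_Ioi_iff_integrableOn_Ioo (g : ℝ → ℂ) :
    IntegrableOn g (Set.Ioi (0 : ℝ))
      ↔ IntegrableOn (fun r : ℝ => ((1 - r) ^ 2)⁻¹ • g (r / (1 - r))) (Set.Ioo (0 : ℝ) 1) := by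
  rw [← image_div_one_sub_Ioo, integrableOn_image_iff_integrableOn_abs_deriv_smul measurableSet_Ioo
    (fun r hr => (hasDerivAt_div_one_sub hr.2).hasDerivWithinAt) injOn_div_one_sub]
  refine integrableOn_congr_fun (fun r _ => ?_) measurableSet_Ioo
  simp only [abs_of_nonneg (inv_nonneg.2 (sq_nonneg (1 - r)))]

lemma inv_sq_eq_exp {a : ℝ} (ha : 0 < a) :
    (((a ^ 2)⁻¹ : ℝ) : ℂ) = Complex.exp (-2 * (Real.log a : ℂ)) := by
  have : (a ^ 2)⁻¹ = Real.exp (-2 * Real.log a) := by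
    rw [show -2 * Real.log a = -(2 * Real.log a) by ring, Real.exp_neg, two_mul, Real.exp_add,
      Real.exp_log ha, sq]
  rw [this]; push_cast; rfl

lemma integrableOn_beta {x y : ℂ} (hx : 0 < x.re) (hy : 0 < y.re) :
    IntegrableOn (fun r : ℝ => (r : ℂ) ^ (x - 1) * (1 - r : ℂ) ^ (y - 1)) (Set.Ioo 0 1) := by
  have := Complex.betaIntegral_convergent hx hy
  rw [intervalIntegrable_iff_integrableOn_Ioo_of_le zero_le_one] at this
  exact this

lemma integral_beta {x y : ℂ} (hx : 0 < x.re) (hy : 0 < y.re) :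
    ∫ r in Set.Ioo (0 : ℝ) 1, (r : ℂ) ^ (x - 1) * (1 - r : ℂ) ^ (y - 1)
      = Gamma x * Gamma y / Gamma (x + y) := by
  rw [← Complex.betaIntegral_eq_Gamma_mul_div _ _ hx hy, betaIntegral,
    intervalIntegral.integral_of_le zero_le_one, integral_Ioc_eq_integral_Ioo]

lemma beta_prime_integrand_comp (x y : ℂ) {r : ℝ} (hr : r ∈ Set.Ioo (0 : ℝ) 1) :
    ((1 - r) ^ 2)⁻¹ • (((r / (1 - r) : ℝ) : ℂ) ^ (x - 1) * (1 + ((r / (1 - r) : ℝ) : ℂ)) ^ (-(x + y)))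
      = (r : ℂ) ^ (x - 1) * (1 - r : ℂ) ^ (y - 1) := by
  have h0 := hr.1
  have h1 : 0 < 1 - r := by linarith [hr.2]
  have e1 : (1 + ((r / (1 - r) : ℝ) : ℂ)) = (((1 - r)⁻¹ : ℝ) : ℂ) := by
    rw [← Complex.ofReal_one, ← Complex.ofReal_add]; congr 1; field_simp; ring
  have e2 : (1 - r : ℂ) = ((1 - r : ℝ) : ℂ) := by push_cast; ring
  rw [e1, e2, ofReal_cpow_eq_exp (div_pos h0 h1), ofReal_cpow_eq_exp (inv_pos.2 h1),
    ofReal_cpow_eq_exp h0, ofReal_cpow_eq_exp h1, Real.log_inv, Real.log_div h0.ne' h1.ne',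
    Complex.real_smul, inv_sq_eq_exp h1, ← Complex.exp_add, ← Complex.exp_add, ← Complex.exp_add]
  congr 1
  push_cast
  ring

lemma integrableOn_beta_prime {x y : ℂ} (hx : 0 < x.re) (hy : 0 < y.re) :
    IntegrableOn (fun w : ℝ => (w : ℂ) ^ (x - 1) * (1 + w : ℂ) ^ (-(x + y))) (Set.Ioi 0) := by
  rw [integrableOn_Ioi_iff_integrableOn_Ioo]
  exact (integrableOn_congr_fun (fun r hr => beta_prime_integrand_comp x y hr)
    measurableSet_Ioo).2 (integrableOn_beta hx hy)

lemma integral_beta_prime {x y : ℂ} (hx : 0 < x.re) (hy : 0 < y.re) :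
    ∫ w in Set.Ioi (0 : ℝ), (w : ℂ) ^ (x - 1) * (1 + w : ℂ) ^ (-(x + y))
      = Gamma x * Gamma y / Gamma (x + y) := by
  rw [integral_Ioi_eq_integral_Ioo, ← integral_beta hx hy]
  exact setIntegral_congr_fun measurableSet_Ioo fun r hr => beta_prime_integrand_comp x y hr

/-! ### Mellin inversion for two Gamma factors, and exchange of integrals. -/

lemma mellinInv_congr {σ : ℝ} {f g : ℂ → ℂ} (h : ∀ v : ℂ, v.re = σ → f v = g v) (x : ℝ) :
    mellinInv σ f x = mellinInv σ g x := by
  unfold mellinInv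
  congr 2
  ext t
  rw [h _ (by simp)]

lemma verticalIntegrable_congr {σ : ℝ} {f g : ℂ → ℂ} (h : ∀ v : ℂ, v.re = σ → f v = g v)
    (hf : VerticalIntegrable f σ) : VerticalIntegrable g σ := by
  unfold VerticalIntegrable at *
  refine hf.congr (Eventually.of_forall fun t => ?_)
  exact h _ (by simp)

lemma mellinInv_const_mul (σ : ℝ) (C : ℂ) (f : ℂ → ℂ) (x : ℝ) :
    mellinInv σ (fun v => C * f v) x = C * mellinInv σ f x := by
  unfold mellinInv
  rw [mul_smul_comm, ← integral_const_mul]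
  congr 2
  ext t
  simp only [smul_eq_mul]
  ring

/-- By the Beta integral on (0,∞), the Mellin transform of w^α (1+w)^(-(α+β)) is
Γ(α+v)Γ(β-v)/Γ(α+β); Mellin inversion applies. -/
lemma mellinInv_Gamma_mul_Gamma {α β : ℂ} {σ : ℝ} (hα : 0 < α.re + σ) (hβ : 0 < β.re - σ) {w : ℝ}
    (hw : 0 < w) :
    mellinInv σ (fun v => Gamma (α + v) * Gamma (β - v)) w
      = Gamma (α + β) * ((w : ℂ) ^ α * (1 + w : ℂ) ^ (-(α + β))) := by
  have hG : Gamma (α + β) ≠ 0 := Complex.Gamma_ne_zero_of_re_pos (by simp; linarith)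
  set f : ℝ → ℂ := fun w => (w : ℂ) ^ α * (1 + w : ℂ) ^ (-(α + β)) with hf
  have hcongr : ∀ v : ℂ, ∀ w ∈ Set.Ioi (0 : ℝ), (w : ℂ) ^ (v - 1) • f w
      = (w : ℂ) ^ (α + v - 1) * (1 + w : ℂ) ^ (-((α + v) + (β - v))) := by
    intro v w hw
    have : (w : ℂ) ≠ 0 := Complex.ofReal_ne_zero.2 (ne_of_gt hw)
    rw [show α + v - 1 = (v - 1) + α by ring, Complex.cpow_add _ _ this,
      show (α + v) + (β - v) = α + β by ring, hf]
    simp only [smul_eq_mul]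
    ring
  have hm : ∀ v : ℂ, v.re = σ →
      mellin f v = (Gamma (α + β))⁻¹ * (Gamma (α + v) * Gamma (β - v)) := by
    intro v hv
    rw [mellin, setIntegral_congr_fun measurableSet_Ioi (hcongr v), integral_beta_prime
      (by simpa [hv] using hα) (by simpa [hv] using hβ),
      show (α + v) + (β - v) = α + β by ring]
    field_simp
  have hconv : MellinConvergent f σ :=
    (integrableOn_congr_fun (hcongr σ) measurableSet_Ioi).2
      (integrableOn_beta_prime (by simpa using hα) (by simpa using hβ))
  have hV : VerticalIntegrable (mellin f) σ := by
    refine verticalIntegrable_congr (fun v hv => (hm v hv).symm) ?_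
    exact (verticalIntegrable_Gamma_mul_Gamma hα hβ).const_mul _
  have hc : ContinuousAt f w := by
    have h1 : ContinuousAt (fun w : ℝ => (w : ℂ) ^ α) w :=
      Complex.continuous_ofReal.continuousAt.cpow continuousAt_const
        (Complex.ofReal_mem_slitPlane.2 hw)
    have h2 : ContinuousAt (fun w : ℝ => (1 + w : ℂ) ^ (-(α + β))) w := by
      refine ContinuousAt.cpow (by fun_prop) continuousAt_const ?_
      rw [← Complex.ofReal_one, ← Complex.ofReal_add]
      exact Complex.ofReal_mem_slitPlane.2 (by positivity)
    exact h1.mul h2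
  have h := mellinInv_mellin_eq σ f hw hconv hV hc
  rw [mellinInv_congr hm, mellinInv_const_mul] at h
  change _ = Gamma (α + β) * f w
  rw [← h, mul_inv_cancel_left₀ hG]

/-- Mellin inversion for w^p (1-w)^(b-p-1) cut off outside (0,1). The Beta integral needs only
Re(b-p) > 0; the stronger hypothesis makes the transform integrable on the line. -/
lemma mellinInv_Gamma_div_Gamma {p b : ℂ} {σ : ℝ} (hp : 0 < p.re + σ) (hb : 1 < (b - p).re) {w : ℝ}
    (hw : 0 < w) (hw1 : w < 1) :
    mellinInv σ (fun v => Gamma (p + v) / Gamma (b + v)) w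
      = (Gamma (b - p))⁻¹ * ((w : ℂ) ^ p * (1 - w : ℂ) ^ (b - p - 1)) := by
  have hG : Gamma (b - p) ≠ 0 := Complex.Gamma_ne_zero_of_re_pos (by linarith)
  set f : ℝ → ℂ := (Set.Ioo (0 : ℝ) 1).indicator
    fun w => (w : ℂ) ^ p * (1 - w : ℂ) ^ (b - p - 1) with hf
  have hcongr : ∀ v : ℂ, (fun w : ℝ => (w : ℂ) ^ (v - 1) • f w)
      = (Set.Ioo (0 : ℝ) 1).indicator
        fun w : ℝ => (w : ℂ) ^ (p + v - 1) * (1 - w : ℂ) ^ (b - p - 1) := by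
    intro v
    ext w
    by_cases hw : w ∈ Set.Ioo (0 : ℝ) 1
    · have : (w : ℂ) ≠ 0 := Complex.ofReal_ne_zero.2 (ne_of_gt hw.1)
      rw [hf, Set.indicator_of_mem hw, Set.indicator_of_mem hw,
        show p + v - 1 = (v - 1) + p by ring, Complex.cpow_add _ _ this, smul_eq_mul]
      ring
    · rw [hf, Set.indicator_of_notMem hw, Set.indicator_of_notMem hw, smul_zero]
  have hsub : Set.Ioo (0 : ℝ) 1 ⊆ Set.Ioi 0 := fun r hr => hr.1
  have hm : ∀ v : ℂ, v.re = σ → mellin f v = Gamma (b - p) * (Gamma (p + v) / Gamma (b + v)) := by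
    intro v hv
    rw [mellin, hcongr v, setIntegral_indicator measurableSet_Ioo,
      Set.inter_eq_self_of_subset_right hsub, integral_beta (by simpa [hv] using hp)
      (by linarith), show p + v + (b - p) = b + v by ring]
    ring
  have hconv : MellinConvergent f σ := by
    rw [MellinConvergent, hcongr]
    refine ((integrable_indicator_iff measurableSet_Ioo).2 ?_).integrableOn
    exact integrableOn_beta (by simpa using hp) (by linarith)
  have hV : VerticalIntegrable (mellin f) σ := by
    refine verticalIntegrable_congr (fun v hv => (hm v hv).symm) ?_
    exact (verticalIntegrable_Gamma_div_Gamma hp hb).const_mul _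
  have hc : ContinuousAt f w := by
    have h1 : ContinuousAt (fun w : ℝ => (w : ℂ) ^ p) w :=
      Complex.continuous_ofReal.continuousAt.cpow continuousAt_const
        (Complex.ofReal_mem_slitPlane.2 hw)
    have h2 : ContinuousAt (fun w : ℝ => (1 - w : ℂ) ^ (b - p - 1)) w := by
      refine ContinuousAt.cpow (by fun_prop) continuousAt_const ?_
      rw [← Complex.ofReal_one, ← Complex.ofReal_sub]
      exact Complex.ofReal_mem_slitPlane.2 (by linarith)
    refine (h1.mul h2).congr ?_
    filter_upwards [Ioo_mem_nhds hw hw1] with r hr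
    rw [hf, Set.indicator_of_mem hr]
    rfl
  have h := mellinInv_mellin_eq σ f hw hconv hV hc
  rw [mellinInv_congr hm, mellinInv_const_mul, hf,
    Set.indicator_of_mem (show w ∈ Set.Ioo (0 : ℝ) 1 from ⟨hw, hw1⟩)] at h
  rw [← h, inv_mul_cancel_left₀ hG]

/-- Exchange of a Mellin inversion integral with an integral defining one factor. -/
lemma mellinInv_mul_integral {σ : ℝ} {M₁ M₂ : ℂ → ℂ} {h : ℝ → ℂ} {κ : ℝ → ℝ} {s : Set ℝ}
    (hs : MeasurableSet s) (hκ : Measurable κ) (hκ0 : ∀ y ∈ s, 0 < κ y)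
    (hM₁ : VerticalIntegrable M₁ σ)
    (hh : IntegrableOn (fun y => h y * (κ y : ℂ) ^ (-(σ : ℂ))) s)
    (hM₂ : ∀ v : ℂ, v.re = σ → M₂ v = ∫ y in s, h y * (κ y : ℂ) ^ (-v)) {z : ℝ} (hz : 0 < z) :
    mellinInv σ (fun v => M₁ v * M₂ v) z = ∫ y in s, h y * mellinInv σ M₁ (z * κ y) := by
  rw [mellinInv_congr (g := fun v => M₁ v * ∫ y in s, h y * (κ y : ℂ) ^ (-v))
    (fun v hv => by rw [hM₂ v hv])]
  unfold mellinInv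
  set F : ℝ → ℝ → ℂ := fun t y => (z : ℂ) ^ (-(σ + t * I)) * M₁ (σ + t * I) *
    (h y * (κ y : ℂ) ^ (-(σ + t * I))) with hF
  have hint : Integrable (Function.uncurry F) (volume.prod (volume.restrict s)) := by
    have hz1 : Integrable (fun t : ℝ => (z : ℂ) ^ (-(σ + t * I)) * M₁ (σ + t * I)) := by
      refine Integrable.bdd_mul (c := z ^ (-σ)) hM₁ ?_ ?_
      · have : Continuous fun t : ℝ => (z : ℂ) ^ (-(σ + t * I) : ℂ) :=
          Continuous.const_cpow (by fun_prop) (Or.inl (Complex.ofReal_ne_zero.2 hz.ne'))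
        exact this.aestronglyMeasurable
      · refine Eventually.of_forall fun t => ?_
        rw [Complex.norm_cpow_eq_rpow_re_of_pos hz]
        simp
    have h2 := hz1.mul_prod hh
    -- The variables t and y are coupled only through the factor exp(-it log κ(y)), of modulus one.
    -- What remains is a product of integrable functions of t and of y, so Fubini applies.
    have h3 : Integrable (fun a : ℝ × ℝ => Complex.exp (-((a.1 * Real.log (κ a.2) : ℝ) * I)) *
        ((z : ℂ) ^ (-(σ + a.1 * I)) * M₁ (σ + a.1 * I) * (h a.2 * (κ a.2 : ℂ) ^ (-(σ : ℂ)))))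
        (volume.prod (volume.restrict s)) := by
      refine Integrable.bdd_mul (c := 1) h2 ?_ ?_
      · have hm : Measurable fun a : ℝ × ℝ => Complex.exp (-((a.1 * Real.log (κ a.2) : ℝ) * I)) :=
          Complex.measurable_exp.comp ((((Complex.measurable_ofReal.comp
            (measurable_fst.mul (Real.measurable_log.comp (hκ.comp measurable_snd)))).mul_const
              I)).neg)
        exact hm.aestronglyMeasurable
      · refine Eventually.of_forall fun a => ?_
        rw [← neg_mul, ← Complex.ofReal_neg, Complex.norm_exp_ofReal_mul_I]
    refine h3.congr ?_
    have hae : ∀ᵐ a ∂(volume.prod (volume.restrict s) : Measure (ℝ × ℝ)), a.2 ∈ s := by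
      have := Measure.quasiMeasurePreserving_snd (μ := (volume : Measure ℝ))
        (ν := volume.restrict s)
      exact this.ae (ae_restrict_mem hs)
    filter_upwards [hae] with a ha
    simp only [Function.uncurry, hF]
    rw [ofReal_cpow_eq_exp (hκ0 _ ha), ofReal_cpow_eq_exp (hκ0 _ ha),
      show (Real.log (κ a.2) : ℂ) * -(σ + a.1 * I)
        = (-((a.1 * Real.log (κ a.2) : ℝ) * I)) + (Real.log (κ a.2) : ℂ) * -(σ : ℂ) by
          push_cast; ring, Complex.exp_add]
    ring
  have hL : ∀ t : ℝ, (z : ℂ) ^ (-(σ + t * I)) • (M₁ (σ + t * I) *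
      ∫ y in s, h y * (κ y : ℂ) ^ (-(σ + t * I))) = ∫ y in s, F t y := by
    intro t
    simp only [hF]
    rw [integral_const_mul, smul_eq_mul, mul_assoc]
  simp_rw [hL]
  rw [integral_integral_swap hint, ← integral_smul]
  refine setIntegral_congr_fun hs fun y hy => ?_
  simp only [hF]
  rw [mul_smul_comm, ← integral_const_mul]
  congr 2
  ext t
  rw [smul_eq_mul, ofReal_cpow_eq_exp (mul_pos hz (hκ0 y hy)), ofReal_cpow_eq_exp hz,
    ofReal_cpow_eq_exp (hκ0 y hy), Real.log_mul hz.ne' (hκ0 y hy).ne', Complex.ofReal_add, add_mul,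
    Complex.exp_add]
  ring

/-! ### The Gauss-type integral for 0 < z < 1. -/

/-- The value of the Mellin-Barnes integral of `gammaQuotient` inside the unit interval. -/
noncomputable def gaussValue (p q b c : ℂ) (z : ℝ) : ℂ :=
  Gamma (p + q) * (Gamma (b - p))⁻¹ *
    ((z : ℂ) ^ p * regularizedGaussHGFun (1 - b + p) (p + q) (c + p) z)

lemma gaussValue_eq_integral {p q b c : ℂ} (hpq : 0 < (p + q).re) (hc : 0 < (c - q).re) {z : ℝ}
    (hz : 0 < z) (hz1 : z < 1) :
    gaussValue p q b c z = (Gamma (b - p))⁻¹ * (Gamma (c - q))⁻¹ * ((z : ℂ) ^ p *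
      ∫ r in Set.Ioo (0 : ℝ) 1, (r : ℂ) ^ (p + q - 1) * (1 - r : ℂ) ^ (c - q - 1) *
        (1 - r * z : ℂ) ^ (b - p - 1)) := by
  have h := integral_euler (A := 1 - b + p) (B := p + q) (C := c + p) hpq
    (by rwa [show c + p - (p + q) = c - q by ring]) hz.le hz1
  rw [intervalIntegral.integral_of_le zero_le_one, integral_Ioc_eq_integral_Ioo,
    show c + p - (p + q) = c - q by ring, show -(1 - b + p) = b - p - 1 by ring] at h
  rw [h, gaussValue]
  have := Complex.Gamma_ne_zero_of_re_pos hc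
  field_simp

/-- Γ(q-v)/Γ(c-v) is written as a Beta integral over y, and the remaining Γ(p+v)/Γ(b+v) is inverted
at zy < 1. The resulting integral over y is Euler's. -/
lemma mellinInv_gammaQuotient_base {p q b c : ℂ} {σ : ℝ} (hp : 0 < p.re + σ)
    (hq : 0 < q.re - σ) (hb : 1 < (b - p).re) (hc : 0 < (c - q).re) {z : ℝ}
    (hz : 0 < z) (hz1 : z < 1) :
    mellinInv σ (gammaQuotient p q b c) z = gaussValue p q b c z := by
  set h : ℝ → ℂ := fun y => (Gamma (c - q))⁻¹ * ((y : ℂ) ^ (q - 1) * (1 - y : ℂ) ^ (c - q - 1))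
    with hh
  have hG : Gamma (c - q) ≠ 0 := Complex.Gamma_ne_zero_of_re_pos hc
  have hcongr : ∀ v : ℂ, ∀ y ∈ Set.Ioo (0 : ℝ) 1, h y * (y : ℂ) ^ (-v) =
      (Gamma (c - q))⁻¹ * ((y : ℂ) ^ (q - v - 1) * (1 - y : ℂ) ^ (c - q - 1)) := by
    intro v y hy
    have : (y : ℂ) ≠ 0 := Complex.ofReal_ne_zero.2 hy.1.ne'
    rw [show q - v - 1 = (q - 1) + -v by ring, Complex.cpow_add _ _ this]
    simp only [hh]; ring
  have hM₂ : ∀ v : ℂ, v.re = σ → Gamma (q - v) / Gamma (c - v)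
      = ∫ y in Set.Ioo (0 : ℝ) 1, h y * ((id y : ℝ) : ℂ) ^ (-v) := by
    intro v hv
    simp only [id]
    rw [setIntegral_congr_fun measurableSet_Ioo (hcongr v), integral_const_mul,
      integral_beta (by simpa [hv] using hq) hc, show q - v + (c - q) = c - v by ring]
    field_simp
  have hint : IntegrableOn (fun y => h y * ((id y : ℝ) : ℂ) ^ (-(σ : ℂ))) (Set.Ioo 0 1) := by
    refine (integrableOn_congr_fun (hcongr σ) measurableSet_Ioo).2 ?_
    exact (integrableOn_beta (by simpa using hq) hc).const_mul _
  have hF := mellinInv_mul_integral measurableSet_Ioo measurable_id (fun y hy => hy.1)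
    (verticalIntegrable_Gamma_div_Gamma hp hb) hint hM₂ hz
  have e1 : mellinInv σ (gammaQuotient p q b c) z = mellinInv σ
      (fun v => Gamma (p + v) / Gamma (b + v) * (Gamma (q - v) / Gamma (c - v))) z :=
    mellinInv_congr (fun v _ => by rw [gammaQuotient]; field_simp) z
  rw [e1, hF, gaussValue_eq_integral (by simp; linarith) hc hz hz1, ← integral_const_mul,
    ← integral_const_mul]
  refine setIntegral_congr_fun measurableSet_Ioo fun y hy => ?_
  have hy0 : (y : ℂ) ≠ 0 := Complex.ofReal_ne_zero.2 hy.1.ne'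
  simp only [id]
  rw [mellinInv_Gamma_div_Gamma hp hb (mul_pos hz hy.1) (by nlinarith [hy.1, hy.2]),
    Complex.ofReal_mul, Complex.mul_cpow_ofReal_nonneg hz.le hy.1.le,
    show p + q - 1 = p + (q - 1) by ring, Complex.cpow_add _ _ hy0, mul_comm (y : ℂ) z]
  simp only [hh]
  ring

lemma norm_cpow_le_of_mem_Ioo {z : ℝ} (hz : 0 < z) (r : ℝ) :
    ∃ K : ℝ, 0 ≤ K ∧ ∀ y ∈ Set.Ioo (z / 2) (2 * z), y ^ r ≤ K := by
  have hc : ContinuousOn (fun y : ℝ => y ^ r) (Set.Icc (z / 2) (2 * z)) := by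
    intro y hy
    exact (Real.continuousAt_rpow_const _ _ (Or.inl (by linarith [hy.1]))).continuousWithinAt
  obtain ⟨K, hK⟩ := isCompact_Icc.exists_bound_of_continuousOn hc
  refine ⟨K, (norm_nonneg _).trans (hK z ⟨by linarith, by linarith⟩), fun y hy => ?_⟩
  exact (le_abs_self _).trans (hK y ⟨hy.1.le, hy.2.le⟩)

lemma continuous_cpow_vertical {z : ℝ} (hz : 0 < z) (a : ℂ) (σ : ℝ) :
    Continuous fun t : ℝ => (z : ℂ) ^ (a - (σ + t * I)) :=
  Continuous.const_cpow (by fun_prop) (Or.inl (Complex.ofReal_ne_zero.2 hz.ne'))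

lemma continuousAt_mellinInv {σ : ℝ} {M : ℂ → ℂ} (hM : VerticalIntegrable M σ) {z : ℝ}
    (hz : 0 < z) : ContinuousAt (mellinInv σ M) z := by
  obtain ⟨K, hK0, hK⟩ := norm_cpow_le_of_mem_Ioo hz (-σ)
  have hmem : Set.Ioo (z / 2) (2 * z) ∈ 𝓝 z := Ioo_mem_nhds (by linarith) (by linarith)
  unfold mellinInv
  refine ContinuousAt.const_smul (continuousAt_of_dominated
    (bound := fun t : ℝ => K * ‖M (σ + t * I)‖) ?_ ?_ (hM.norm.const_mul K) ?_) _
  · filter_upwards [hmem] with y hy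
    have hy0 : 0 < y := by linarith [hy.1]
    have := (continuous_cpow_vertical hy0 0 σ).aestronglyMeasurable (μ := volume)
    simp only [zero_sub] at this
    exact this.smul hM.1
  · filter_upwards [hmem] with y hy
    have hy0 : 0 < y := by linarith [hy.1]
    refine Eventually.of_forall fun t => ?_
    rw [norm_smul, Complex.norm_cpow_eq_rpow_re_of_pos hy0]
    gcongr
    simpa using hK y hy
  · refine Eventually.of_forall fun t => ?_
    have h : ContinuousAt (fun y : ℝ => (y : ℂ) ^ (-(σ + t * I) : ℂ)) z :=
      Complex.continuous_ofReal.continuousAt.cpow continuousAt_const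
        (Complex.ofReal_mem_slitPlane.2 hz)
    exact h.smul continuousAt_const

lemma cpow_mul_mellinInv (σ : ℝ) (M : ℂ → ℂ) (a : ℂ) {z : ℝ} (hz : 0 < z) :
    (z : ℂ) ^ a * mellinInv σ M z =
      (1 / (2 * Real.pi)) • ∫ t : ℝ, (z : ℂ) ^ (a - (σ + t * I)) * M (σ + t * I) := by
  unfold mellinInv
  rw [mul_smul_comm, ← integral_const_mul]
  congr 2
  ext t
  rw [sub_eq_add_neg, Complex.cpow_add _ _ (Complex.ofReal_ne_zero.2 hz.ne'), smul_eq_mul, mul_assoc]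

/-- Differentiating z^(a-v) brings down a - v. With a = c or a = -b this is the factor relating
neighbouring values of 1/Γ(c-v) or 1/Γ(b+v). -/
lemma hasDerivAt_cpow_mul_mellinInv {σ : ℝ} {M : ℂ → ℂ} (a : ℂ) (hM : VerticalIntegrable M σ)
    (hM' : VerticalIntegrable (fun v => (a - v) * M v) σ) {z : ℝ} (hz : 0 < z) :
    HasDerivAt (fun z : ℝ => (z : ℂ) ^ a * mellinInv σ M z)
      ((z : ℂ) ^ (a - 1) * mellinInv σ (fun v => (a - v) * M v) z) z := by
  obtain ⟨K, hK0, hK⟩ := norm_cpow_le_of_mem_Ioo hz (a.re - 1 - σ)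
  have hmem : Set.Ioo (z / 2) (2 * z) ∈ 𝓝 z := Ioo_mem_nhds (by linarith) (by linarith)
  have hd := hasDerivAt_integral_of_dominated_loc_of_deriv_le (𝕜 := ℝ) (μ := volume)
    (F := fun (y : ℝ) (t : ℝ) => (y : ℂ) ^ (a - (σ + t * I)) * M (σ + t * I))
    (F' := fun (y : ℝ) (t : ℝ) => (y : ℂ) ^ (a - 1 - (σ + t * I)) *
      ((a - (σ + t * I)) * M (σ + t * I)))
    (bound := fun t : ℝ => K * ‖(a - (σ + t * I)) * M (σ + t * I)‖)
    (x₀ := z) hmem ?_ ?_ ?_ ?_ (hM'.norm.const_mul K) ?_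
  · have h2 := hd.2.const_smul (1 / (2 * Real.pi))
    rw [cpow_mul_mellinInv _ _ _ hz]
    refine h2.congr_of_eventuallyEq ?_
    filter_upwards [hmem] with y hy
    rw [cpow_mul_mellinInv _ _ _ (by linarith [hy.1])]
    rfl
  · filter_upwards [hmem] with y hy
    have hy0 : 0 < y := by linarith [hy.1]
    exact ((continuous_cpow_vertical hy0 a σ).aestronglyMeasurable).mul hM.1
  · refine Integrable.bdd_mul (c := z ^ (a.re - σ)) hM
      (continuous_cpow_vertical hz a σ).aestronglyMeasurable (Eventually.of_forall fun t => ?_)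
    rw [Complex.norm_cpow_eq_rpow_re_of_pos hz]
    simp
  · exact ((continuous_cpow_vertical hz (a - 1) σ).aestronglyMeasurable).mul hM'.1
  · refine Eventually.of_forall fun t y hy => ?_
    have hy0 : 0 < y := by linarith [hy.1]
    rw [norm_mul, Complex.norm_cpow_eq_rpow_re_of_pos hy0]
    gcongr
    simpa using hK y hy
  · refine Eventually.of_forall fun t y hy => ?_
    have hy0 : 0 < y := by linarith [hy.1]
    have h1 : HasDerivAt (fun y : ℝ => (y : ℂ) ^ (a - (σ + t * I)))
        ((a - (σ + t * I)) * (y : ℂ) ^ (a - (σ + t * I) - 1)) y := by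
      have := (HasDerivAt.comp_ofReal (((hasDerivAt_id (y : ℂ)).cpow_const (c := a - (σ + t * I))
        (Complex.ofReal_mem_slitPlane.2 hy0))))
      simpa using this
    refine (h1.mul_const (M (σ + t * I))).congr_deriv ?_
    rw [show a - 1 - (σ + t * I) = a - (σ + t * I) - 1 by ring]
    ring

/-- The counterpart for series: the n-th coefficient acquires the factor μ + n. -/
lemma hasDerivAt_cpow_mul_tsum {a : ℕ → ℂ} (ha : ∀ z : ℂ, ‖z‖ < 1 → Summable fun n => ‖a n * z ^ n‖)
    (μ : ℂ) {z : ℝ} (hz : 0 < z) (hz1 : z < 1) :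
    HasDerivAt (fun z : ℝ => (z : ℂ) ^ μ * ∑' n, a n * (z : ℂ) ^ n)
      ((z : ℂ) ^ (μ - 1) * ∑' n : ℕ, (μ + n) * a n * (z : ℂ) ^ n) z := by
  obtain ⟨R, hzR, hR1⟩ := exists_between hz1
  have hR0 : 0 < R := hz.trans hzR
  have hRn : ‖(R : ℂ)‖ < 1 := by rwa [Complex.norm_real, Real.norm_of_nonneg hR0.le]
  have hzmem : (z : ℂ) ∈ Metric.ball (0 : ℂ) R := by
    simpa [abs_of_pos hz] using hzR
  have hz0 : (z : ℂ) ≠ 0 := Complex.ofReal_ne_zero.2 hz.ne'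
  have hdiff : ∀ n, DifferentiableOn ℂ (fun w : ℂ => a n * w ^ n) (Metric.ball 0 R) :=
    fun n => by fun_prop
  have hle : ∀ n, ∀ w ∈ Metric.ball (0 : ℂ) R, ‖a n * w ^ n‖ ≤ ‖a n * (R : ℂ) ^ n‖ := by
    intro n w hw
    rw [norm_mul, norm_mul, norm_pow, norm_pow, Complex.norm_real, Real.norm_of_nonneg hR0.le]
    have : ‖w‖ < R := by simpa using hw
    gcongr
  have h1 := Complex.hasSum_deriv_of_summable_norm (ha _ hRn) hdiff Metric.isOpen_ball hle hzmem
  have h2 := (Complex.differentiableOn_tsum_of_summable_norm (ha _ hRn) hdiff Metric.isOpen_ball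
    hle).differentiableAt (Metric.isOpen_ball.mem_nhds hzmem)
  have h3 : HasDerivAt (fun w : ℂ => w ^ μ) (μ * (z : ℂ) ^ (μ - 1)) z := by
    simpa using (hasDerivAt_id (z : ℂ)).cpow_const (c := μ) (Complex.ofReal_mem_slitPlane.2 hz)
  refine (h3.mul h2.hasDerivAt).comp_ofReal.congr_deriv ?_
  have hsum : Summable fun n => a n * (z : ℂ) ^ n :=
    (ha z (by rw [Complex.norm_real, Real.norm_of_nonneg hz.le]; exact hz1)).of_norm
  have h4 : HasSum (fun n : ℕ => μ * (a n * (z : ℂ) ^ n) + z * deriv (fun w : ℂ => a n * w ^ n) z)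
      (μ * (∑' n, a n * (z : ℂ) ^ n) + z * deriv (fun w => ∑' n, a n * w ^ n) z) :=
    (hsum.hasSum.mul_left μ).add (h1.mul_left _)
  have h5 : ∀ n : ℕ, μ * (a n * (z : ℂ) ^ n) + z * deriv (fun w : ℂ => a n * w ^ n) z
      = (μ + n) * a n * (z : ℂ) ^ n := by
    intro n
    have : deriv (fun w : ℂ => a n * w ^ n) z = a n * (n * (z : ℂ) ^ (n - 1)) := by
      simp
    rw [this]
    rcases n with _ | n
    · simp
    · rw [Nat.add_sub_cancel, pow_succ]; push_cast; ring
  simp_rw [h5] at h4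
  rw [h4.tsum_eq, Complex.cpow_sub _ _ hz0, Complex.cpow_one]
  field_simp

lemma ofReal_cpow_ne_zero {z : ℝ} (hz : 0 < z) (a : ℂ) : (z : ℂ) ^ a ≠ 0 := by
  rw [ofReal_cpow_eq_exp hz]
  exact Complex.exp_ne_zero _

lemma verticalIntegrable_const_mul {f : ℂ → ℂ} {σ : ℝ} (hf : VerticalIntegrable f σ) (C : ℂ) :
    VerticalIntegrable (fun v => C * f v) σ :=
  Integrable.const_mul hf C

lemma gammaQuotient_succ_right (p q b c v : ℂ) :
    gammaQuotient p q b c v = (c - v) * gammaQuotient p q b (c + 1) v := by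
  unfold gammaQuotient
  rw [Complex.one_div_Gamma_eq_self_mul_one_div_Gamma_add_one (c - v),
    show c - v + 1 = c + 1 - v by ring]
  ring

lemma gammaQuotient_succ_left (p q b c v : ℂ) :
    gammaQuotient p q b c v = (b + v) * gammaQuotient p q (b + 1) c v := by
  unfold gammaQuotient
  rw [Complex.one_div_Gamma_eq_self_mul_one_div_Gamma_add_one (b + v),
    show b + v + 1 = b + 1 + v by ring]
  ring

lemma gammaQuotient_neg (p q b c v : ℂ) :
    gammaQuotient p q b c (-v) = gammaQuotient q p c b v := by
  unfold gammaQuotient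
  simp only [sub_neg_eq_add, ← sub_eq_add_neg]
  ring

lemma summable_norm_gaussValue_terms (C A B D : ℂ) {z : ℂ} (hz : ‖z‖ < 1) :
    Summable fun n : ℕ => ‖C * ((ascPochhammer ℂ n).eval A *
      (ascPochhammer ℂ n).eval B / (n.factorial * Gamma (D + n))) * z ^ n‖ := by
  refine ((summable_norm_regularizedGaussHG A B D hz).mul_left ‖C‖).congr fun n => ?_
  rw [← norm_mul, mul_assoc]

lemma cpow_mul_gaussValue (p q b c a : ℂ) {z : ℝ} (hz : 0 < z) :
    (z : ℂ) ^ a * gaussValue p q b c z = (z : ℂ) ^ (a + p) * ∑' n : ℕ,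
      Gamma (p + q) * (Gamma (b - p))⁻¹ * ((ascPochhammer ℂ n).eval (1 - b + p) *
      (ascPochhammer ℂ n).eval (p + q) / (n.factorial * Gamma (c + p + n))) * (z : ℂ) ^ n := by
  rw [gaussValue, regularizedGaussHGFun_eq_tsum, Complex.cpow_add _ _
    (Complex.ofReal_ne_zero.2 hz.ne')]
  simp_rw [mul_assoc (Gamma (p + q) * (Gamma (b - p))⁻¹), tsum_mul_left]
  ring

/-- Coefficientwise this is (c+p+n)/Γ(c+p+n+1) = 1/Γ(c+p+n), valid even at the poles. -/
lemma hasDerivAt_cpow_mul_gaussValue_right (p q b c : ℂ) {z : ℝ} (hz : 0 < z) (hz1 : z < 1) :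
    HasDerivAt (fun z : ℝ => (z : ℂ) ^ c * gaussValue p q b (c + 1) z)
      ((z : ℂ) ^ (c - 1) * gaussValue p q b c z) z := by
  have h := hasDerivAt_cpow_mul_tsum (fun w hw => summable_norm_gaussValue_terms
    (Gamma (p + q) * (Gamma (b - p))⁻¹) (1 - b + p) (p + q) (c + 1 + p) hw) (c + p) hz hz1
  refine (h.congr_of_eventuallyEq ?_).congr_deriv ?_
  · filter_upwards [Ioi_mem_nhds hz] with y hy
    exact cpow_mul_gaussValue _ _ _ _ _ hy
  · rw [cpow_mul_gaussValue _ _ _ _ _ hz, show c - 1 + p = c + p - 1 by ring]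
    congr 1
    refine tsum_congr fun n => ?_
    have h1 := Complex.one_div_Gamma_eq_self_mul_one_div_Gamma_add_one (c + p + n)
    rw [show c + p + n + 1 = c + 1 + p + n by ring] at h1
    simp only [div_eq_mul_inv, mul_inv]
    rw [h1]
    ring

lemma ascPochhammer_eval_add_one_mul (a : ℂ) (n : ℕ) :
    (a + n) * (ascPochhammer ℂ n).eval a = a * (ascPochhammer ℂ n).eval (a + 1) := by
  have h1 := ascPochhammer_succ_eval (S := ℂ) n a
  have h2 : (ascPochhammer ℂ (n + 1)).eval a = a * (ascPochhammer ℂ n).eval (a + 1) := by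
    rw [ascPochhammer_succ_left]; simp
  rw [← h2, h1]; ring

/-- The factor p-b+n turns (p-b)_n into (p-b)(1-b+p)_n, and the extra p-b combines with 1/Γ(b+1-p)
to -1/Γ(b-p). -/
lemma hasDerivAt_cpow_mul_gaussValue_left (p q b c : ℂ) {z : ℝ} (hz : 0 < z) (hz1 : z < 1) :
    HasDerivAt (fun z : ℝ => (z : ℂ) ^ (-b) * gaussValue p q (b + 1) c z)
      (-((z : ℂ) ^ (-b - 1) * gaussValue p q b c z)) z := by
  have h := hasDerivAt_cpow_mul_tsum (fun w hw => summable_norm_gaussValue_terms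
    (Gamma (p + q) * (Gamma (b + 1 - p))⁻¹) (1 - (b + 1) + p) (p + q) (c + p) hw) (-b + p) hz hz1
  refine (h.congr_of_eventuallyEq ?_).congr_deriv ?_
  · filter_upwards [Ioi_mem_nhds hz] with y hy
    exact cpow_mul_gaussValue _ _ _ _ _ hy
  · rw [cpow_mul_gaussValue _ _ _ _ _ hz, show -b - 1 + p = -b + p - 1 by ring, ← mul_neg,
      ← tsum_neg]
    congr 1
    refine tsum_congr fun n => ?_
    have h1 := Complex.one_div_Gamma_eq_self_mul_one_div_Gamma_add_one (b - p)
    have h2 := ascPochhammer_eval_add_one_mul (-b + p) n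
    rw [show b - p + 1 = b + 1 - p by ring] at h1
    rw [h1, show 1 - (b + 1) + p = -b + p by ring, show 1 - b + p = -b + p + 1 by ring]
    linear_combination (Gamma (p + q) * (Gamma (b + 1 - p))⁻¹ * (ascPochhammer ℂ n).eval (p + q)
      / (n.factorial * Gamma (c + p + n)) * (z : ℂ) ^ n) * h2

/-- The Mellin-Barnes integral inside the unit interval. -/
theorem mellinInv_gammaQuotient {p q b c : ℂ} {σ : ℝ} (hp : 0 < p.re + σ)
    (hq : 0 < q.re - σ) (hS : 1 < (b + c - p - q).re) {z : ℝ} (hz : 0 < z) (hz1 : z < 1) :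
    mellinInv σ (gammaQuotient p q b c) z = gaussValue p q b c z := by
  -- N and M count how often b and c are raised before the base case applies. The identity at b+1 or
  -- c+1 holds on all of (0,1), so both sides can be differentiated there; the hypothesis on b + c -
  -- p - q is exactly what keeps the differentiated integral absolutely convergent.
  have key : ∀ N M : ℕ, ∀ b c : ℂ, 1 < (b + c - p - q).re → 1 < (b - p).re + N →
      0 < (c - q).re + M → ∀ z : ℝ, 0 < z → z < 1 →
      mellinInv σ (gammaQuotient p q b c) z = gaussValue p q b c z := by
    intro N
    induction N with
    | zero =>
      intro M
      induction M with
      | zero =>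
        intro b c _ hb hc z hz hz1
        exact mellinInv_gammaQuotient_base hp hq (by simpa using hb) (by simpa using hc) hz hz1
      | succ M ih =>
        intro b c hS hb hc z hz hz1
        have hS' : 1 < (b + (c + 1) - p - q).re := by
          simp only [add_re, sub_re, one_re] at hS ⊢; linarith
        have hE := ih b (c + 1) hS' hb
          (by push_cast at hc; simp only [add_re, sub_re, one_re] at hc ⊢; linarith)
        have h1 := hasDerivAt_cpow_mul_mellinInv c (verticalIntegrable_gammaQuotient hp hq hS')
          (by
            simp_rw [← gammaQuotient_succ_right]
            exact verticalIntegrable_gammaQuotient hp hq hS) hz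
        simp_rw [← gammaQuotient_succ_right] at h1
        have h2 := hasDerivAt_cpow_mul_gaussValue_right p q b c hz hz1
        have h3 := h1.unique (h2.congr_of_eventuallyEq (by
          filter_upwards [Ioo_mem_nhds hz hz1] with y hy
          rw [hE y hy.1 hy.2]))
        exact mul_left_cancel₀ (ofReal_cpow_ne_zero hz _) h3
    | succ N ih =>
      intro M b c hS hb hc z hz hz1
      have hS' : 1 < ((b + 1) + c - p - q).re := by
        simp only [add_re, sub_re, one_re] at hS ⊢; linarith
      have hE := ih M (b + 1) c hS'
        (by push_cast at hb; simp only [add_re, sub_re, one_re] at hb ⊢; linarith) hc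
      have hM : ∀ v, (-b - v) * gammaQuotient p q (b + 1) c v = -1 * gammaQuotient p q b c v := by
        intro v; rw [gammaQuotient_succ_left p q b c]; ring
      have h1 := hasDerivAt_cpow_mul_mellinInv (-b) (verticalIntegrable_gammaQuotient hp hq hS')
        (by
          simp_rw [hM]
          exact (verticalIntegrable_gammaQuotient hp hq hS).const_mul _) hz
      simp_rw [hM] at h1
      rw [mellinInv_const_mul] at h1
      have h2 := hasDerivAt_cpow_mul_gaussValue_left p q b c hz hz1
      have h3 := h1.unique (h2.congr_of_eventuallyEq (by
        filter_upwards [Ioo_mem_nhds hz hz1] with y hy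
        rw [hE y hy.1 hy.2]))
      rw [neg_one_mul, mul_neg, neg_inj] at h3
      exact mul_left_cancel₀ (ofReal_cpow_ne_zero hz _) h3
  obtain ⟨N, hN⟩ := exists_nat_gt (1 - (b - p).re)
  obtain ⟨M, hM⟩ := exists_nat_gt (-(c - q).re)
  exact key N M b c hS (by linarith) (by linarith) z hz hz1

lemma mellinInv_comp_neg (σ : ℝ) (M : ℂ → ℂ) {z : ℝ} (hz : 0 < z) :
    mellinInv (-σ) (fun v => M (-v)) z⁻¹ = mellinInv σ M z := by
  unfold mellinInv
  congr 1
  rw [← integral_neg_eq_self]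
  congr 1
  ext t
  have e : -(((-σ : ℝ) : ℂ) + ((-t : ℝ) : ℂ) * I) = σ + t * I := by push_cast; ring
  rw [e, ofReal_cpow_eq_exp (inv_pos.2 hz), ofReal_cpow_eq_exp hz, Real.log_inv]
  push_cast
  ring_nf

lemma mellinInv_gammaQuotient_inv (p q b c : ℂ) (σ : ℝ) {z : ℝ} (hz : 0 < z) :
    mellinInv σ (gammaQuotient p q b c) z = mellinInv (-σ) (gammaQuotient q p c b) z⁻¹ := by
  rw [← mellinInv_comp_neg σ _ hz]
  simp_rw [gammaQuotient_neg]

/-! ### The Gauss-type integral at z = 1. -/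

/-- The value of the Mellin-Barnes integral of `gammaQuotient` at one. -/
noncomputable def gaussValueOne (p q b c : ℂ) : ℂ :=
  Gamma (p + q) * Gamma (b + c - p - q - 1) *
    ((Gamma (b - p))⁻¹ * (Gamma (c - q))⁻¹ * (Gamma (b + c - 1))⁻¹)

/-- Gauss's summation theorem: as z → 1 the factor (1-rz)^(b-p-1) in Euler's integral merges with
the power of 1-r, and a Beta integral remains. -/
lemma tendsto_gaussValue_one {p q b c : ℂ} (hpq : 0 < (p + q).re) (hc : 0 < (c - q).re)
    (hS : 1 < (b + c - p - q).re) :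
    Tendsto (gaussValue p q b c) (𝓝[<] 1) (𝓝 (gaussValueOne p q b c)) := by
  set F : ℝ → ℝ → ℂ := fun z r => (r : ℂ) ^ (p + q - 1) * (1 - r : ℂ) ^ (c - q - 1) *
        (1 - r * z : ℂ) ^ (b - p - 1) with hF
  have hS' : 0 < (b + c - p - q - 1).re := by simp at hS ⊢; linarith
  have hone : ∀ r ∈ Set.Ioo (0 : ℝ) 1, F 1 r
      = (r : ℂ) ^ (p + q - 1) * (1 - r : ℂ) ^ (b + c - p - q - 1 - 1) := by
    intro r hr
    have hr1 : (1 - r : ℂ) ≠ 0 := by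
      have : (1 - r : ℝ) ≠ 0 := by linarith [hr.2]
      exact_mod_cast this
    simp only [hF]
    rw [Complex.ofReal_one, mul_one, mul_assoc, ← Complex.cpow_add _ _ hr1]
    congr 2; ring
  have hnear : ∀ᶠ z : ℝ in 𝓝[<] 1, z ∈ Set.Ioo (0 : ℝ) 1 := Ioo_mem_nhdsLT zero_lt_one
  have hlim : Tendsto (fun z => ∫ r in Set.Ioo (0 : ℝ) 1, F z r) (𝓝[<] 1)
      (𝓝 (∫ r in Set.Ioo (0 : ℝ) 1, F 1 r)) := by
    -- Since 1-r ≤ 1-rz ≤ 1, the modulus of (1-rz)^(b-p-1) is at most 1 or at most that of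
    -- (1-r)^(b-p-1), according to the sign of the real exponent. The sum of both bounds covers
    -- either case.
    refine tendsto_integral_filter_of_dominated_convergence
      (fun r : ℝ => ‖(r : ℂ) ^ (p + q - 1) * (1 - r : ℂ) ^ (c - q - 1)‖ +
        ‖(r : ℂ) ^ (p + q - 1) * (1 - r : ℂ) ^ (b + c - p - q - 1 - 1)‖) ?_ ?_ ?_ ?_
    · refine Eventually.of_forall fun z => ?_
      refine Measurable.aestronglyMeasurable ?_
      simp only [hF]
      fun_prop
    · filter_upwards [hnear] with z hz
      filter_upwards [ae_restrict_mem measurableSet_Ioo] with r hr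
      have h1r : 0 < 1 - r := by linarith [hr.2]
      have h1rz : 0 < 1 - r * z := by nlinarith [hr.1, hr.2, hz.1, hz.2]
      rw [← hone r hr]
      simp only [hF]
      rw [norm_mul, norm_mul _ ((1 - r * ((1 : ℝ) : ℂ) : ℂ) ^ (b - p - 1)), ← mul_one_add]
      gcongr
      rw [show (1 - r * z : ℂ) = ((1 - r * z : ℝ) : ℂ) by push_cast; ring,
        show (1 - r * ((1 : ℝ) : ℂ) : ℂ) = ((1 - r : ℝ) : ℂ) by push_cast; ring,
        Complex.norm_cpow_eq_rpow_re_of_pos h1rz, Complex.norm_cpow_eq_rpow_re_of_pos h1r]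
      have hpos : 0 ≤ (1 - r) ^ (b - p - 1).re := Real.rpow_nonneg h1r.le _
      rcases le_total 0 (b - p - 1).re with he | he
      · have := Real.rpow_le_one h1rz.le (by nlinarith [hr.1, hz.1]) he
        linarith
      · have := Real.rpow_le_rpow_of_nonpos h1r
          (show 1 - r ≤ 1 - r * z by nlinarith [hr.1, hz.2]) he
        linarith
    · exact (integrableOn_beta hpq hc).norm.add (integrableOn_beta hpq hS').norm
    · filter_upwards [ae_restrict_mem measurableSet_Ioo] with r hr
      have h1r : 0 < 1 - r := by linarith [hr.2]
      have hcont : ContinuousAt (fun z : ℝ => (1 - r * z : ℂ) ^ (b - p - 1)) 1 := by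
        refine ContinuousAt.cpow (by fun_prop) continuousAt_const ?_
        rw [show (1 - r * ((1 : ℝ) : ℂ) : ℂ) = ((1 - r : ℝ) : ℂ) by push_cast; ring]
        exact Complex.ofReal_mem_slitPlane.2 h1r
      exact ((hcont.tendsto.mono_left nhdsWithin_le_nhds).const_mul _)
  have hcp : Tendsto (fun z : ℝ => (z : ℂ) ^ p) (𝓝[<] 1) (𝓝 (((1 : ℝ) : ℂ) ^ p)) := by
    refine Tendsto.mono_left (ContinuousAt.tendsto (f := fun z : ℝ => (z : ℂ) ^ p) ?_)
      nhdsWithin_le_nhds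
    exact Complex.continuous_ofReal.continuousAt.cpow continuousAt_const
      (Complex.ofReal_mem_slitPlane.2 one_pos)
  have hfin := (hcp.mul hlim).const_mul ((Gamma (b - p))⁻¹ * (Gamma (c - q))⁻¹)
  rw [setIntegral_congr_fun measurableSet_Ioo hone, integral_beta hpq hS', Complex.ofReal_one,
    Complex.one_cpow, one_mul, show p + q + (b + c - p - q - 1) = b + c - 1 by ring] at hfin
  have hval : (Gamma (b - p))⁻¹ * (Gamma (c - q))⁻¹ *
      (Gamma (p + q) * Gamma (b + c - p - q - 1) / Gamma (b + c - 1)) = gaussValueOne p q b c := by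
    rw [gaussValueOne]; ring
  rw [hval] at hfin
  refine hfin.congr' ?_
  filter_upwards [hnear] with z hz
  exact (gaussValue_eq_integral hpq hc hz.1 hz.2).symm

/-- Raising b costs a factor b + v = (b+q) - (q-v), and q - v is absorbed by Γ(q-v). -/
lemma gammaQuotient_recurrence {p q b c v : ℂ} (hv : q - v ≠ 0) :
    gammaQuotient p q b c v = (b + q) * gammaQuotient p q (b + 1) c v
      + -1 * gammaQuotient p (q + 1) (b + 1) c v := by
  rw [gammaQuotient_succ_left]
  unfold gammaQuotient
  rw [show q + 1 - v = (q - v) + 1 by ring, Complex.Gamma_add_one _ hv]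
  ring

lemma gaussValueOne_recurrence {p q b c : ℂ} (hpq : p + q ≠ 0) (hS : b + c - p - q - 1 ≠ 0) :
    gaussValueOne p q b c = (b + q) * gaussValueOne p q (b + 1) c
      + -1 * gaussValueOne p (q + 1) (b + 1) c := by
  unfold gaussValueOne
  have h1 := Complex.one_div_Gamma_eq_self_mul_one_div_Gamma_add_one (b - p)
  have h2 := Complex.one_div_Gamma_eq_self_mul_one_div_Gamma_add_one (c - (q + 1))
  have h3 := Complex.one_div_Gamma_eq_self_mul_one_div_Gamma_add_one (b + c - 1)
  rw [show b - p + 1 = b + 1 - p by ring] at h1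
  rw [show c - (q + 1) + 1 = c - q by ring] at h2
  rw [show b + c - 1 + 1 = b + 1 + c - 1 by ring] at h3
  rw [h1, h2, h3, show p + (q + 1) = p + q + 1 by ring, Complex.Gamma_add_one _ hpq,
    show b + 1 + c - p - q - 1 = b + c - p - q - 1 + 1 by ring, Complex.Gamma_add_one _ hS,
    show b + 1 + c - p - (q + 1) - 1 = b + c - p - q - 1 by ring]
  ring

lemma gaussValueOne_swap (p q b c : ℂ) : gaussValueOne p q b c = gaussValueOne q p c b := by
  unfold gaussValueOne
  rw [add_comm p q, add_comm b c, show c + b - p - q - 1 = c + b - q - p - 1 by ring]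
  ring

lemma mellinInv_add {σ : ℝ} {f g : ℂ → ℂ} (hf : VerticalIntegrable f σ)
    (hg : VerticalIntegrable g σ) {z : ℝ} (hz : 0 < z) :
    mellinInv σ (fun v => f v + g v) z = mellinInv σ f z + mellinInv σ g z := by
  have hb : ∀ f : ℂ → ℂ, VerticalIntegrable f σ →
      Integrable (fun t : ℝ => (z : ℂ) ^ (-(σ + t * I)) • f (σ + t * I)) := by
    intro f hf
    refine Integrable.bdd_mul (c := z ^ (-σ)) hf ?_ (Eventually.of_forall fun t => ?_)
    · have := (continuous_cpow_vertical hz 0 σ).aestronglyMeasurable (μ := volume)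
      simpa only [zero_sub] using this
    · rw [Complex.norm_cpow_eq_rpow_re_of_pos hz]
      simp
  unfold mellinInv
  rw [← smul_add, ← integral_add (hb f hf) (hb g hg)]
  simp only [smul_add]

/-- The case N = 0 is the limit z → 1 from below: the integral is continuous in z and its values on
(0,1) tend to Gauss's sum. The inductive step uses that both sides obey the same three-term
recurrence. -/
lemma mellinInv_gammaQuotient_one_of_pos {p q b c : ℂ} {σ : ℝ} (hp : 0 < p.re + σ)
    (hq : 0 < q.re - σ) (hc : 0 < (c - q).re) (hS : 1 < (b + c - p - q).re) :
    mellinInv σ (gammaQuotient p q b c) 1 = gaussValueOne p q b c := by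
  have key : ∀ N : ℕ, ∀ q b : ℂ, 0 < q.re - σ → 0 < (c - q).re → 1 < (b + c - p - q).re →
      0 < (b - p).re + N → mellinInv σ (gammaQuotient p q b c) 1 = gaussValueOne p q b c := by
    intro N
    induction N with
    | zero =>
      intro q b hq hc hS hb
      have h1 : Tendsto (mellinInv σ (gammaQuotient p q b c)) (𝓝[<] 1)
          (𝓝 (mellinInv σ (gammaQuotient p q b c) 1)) :=
        (continuousAt_mellinInv (verticalIntegrable_gammaQuotient hp hq hS) one_pos).tendsto.mono_left
          nhdsWithin_le_nhds
      have h2 := tendsto_gaussValue_one (p := p) (by simp; linarith) hc hS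
      refine tendsto_nhds_unique h1 (h2.congr' ?_)
      filter_upwards [Ioo_mem_nhdsLT zero_lt_one] with z hz
      exact (mellinInv_gammaQuotient hp hq hS hz.1 hz.2).symm
    | succ N ih =>
      intro q b hq hc hS hb
      by_cases hb0 : 0 < (b - p).re + N
      · exact ih q b hq hc hS hb0
      have hbN : (b - p).re ≤ 0 := by
        have : (0 : ℝ) ≤ N := N.cast_nonneg
        linarith
      have hS1 : 1 < (b + 1 + c - p - q).re := by
        simp only [add_re, sub_re, one_re] at hS ⊢; linarith
      have hS2 : 1 < (b + 1 + c - p - (q + 1)).re := by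
        simp only [add_re, sub_re, one_re] at hS ⊢; linarith
      have hq2 : 0 < (q + 1).re - σ := by simp only [add_re, one_re]; linarith
      have hb1 : 0 < (b + 1 - p).re + N := by
        push_cast at hb
        simp only [add_re, sub_re, one_re] at hb ⊢; linarith
      have e1 := ih q (b + 1) hq hc hS1 hb1
      have e2 := ih (q + 1) (b + 1) hq2
        (by simp only [add_re, sub_re, one_re] at hS hbN ⊢; linarith) hS2 hb1
      rw [mellinInv_congr (g := fun v => (b + q) * gammaQuotient p q (b + 1) c v
        + -1 * gammaQuotient p (q + 1) (b + 1) c v) (fun v hv => gammaQuotient_recurrence (by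
          intro h
          have := congrArg Complex.re h
          simp [hv] at this
          linarith)), mellinInv_add
          (verticalIntegrable_const_mul (verticalIntegrable_gammaQuotient hp hq hS1) _)
          (verticalIntegrable_const_mul (verticalIntegrable_gammaQuotient hp hq2 hS2) _) one_pos,
        mellinInv_const_mul, mellinInv_const_mul, e1, e2, ← gaussValueOne_recurrence]
      · intro h
        have := congrArg Complex.re h
        simp at this
        linarith
      · intro h
        have := congrArg Complex.re h
        simp only [add_re, sub_re, one_re, zero_re] at this hS
        linarith
  obtain ⟨N, hN⟩ := exists_nat_gt (-(b - p).re)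
  exact key N q b hq hc hS (by linarith)

/-- The Mellin-Barnes integral at one. -/
theorem mellinInv_gammaQuotient_one {p q b c : ℂ} {σ : ℝ} (hp : 0 < p.re + σ)
    (hq : 0 < q.re - σ) (hS : 1 < (b + c - p - q).re) :
    mellinInv σ (gammaQuotient p q b c) 1 = gaussValueOne p q b c := by
  by_cases hc : 0 < (c - q).re
  · exact mellinInv_gammaQuotient_one_of_pos hp hq hc hS
  -- If Re(c-q) ≤ 0 then Re(b-p) > 1, and v ↦ -v exchanges (p,b) with (q,c) while fixing z = 1.
  · rw [mellinInv_gammaQuotient_inv _ _ _ _ _ one_pos, inv_one, gaussValueOne_swap]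
    refine mellinInv_gammaQuotient_one_of_pos (by linarith) (by linarith) ?_ ?_
    · simp only [add_re, sub_re] at hS hc ⊢; linarith
    · simp only [add_re, sub_re] at hS hc ⊢; linarith

/-! ### Barnes integrals with four and with three Gamma functions in the numerator. -/

/-- The Mellin-Barnes integral with four Gamma functions in the numerator. -/
theorem mellinInv_barnes_four {a b p q : ℂ} {σ : ℝ} (ha : 0 < a.re + σ)
    (hb : 0 < b.re + σ) (hp : 0 < p.re - σ) (hq : 0 < q.re - σ) {x : ℝ} (hx : 0 < x)
    (hx1 : x < 1) :
    mellinInv σ (fun v => Gamma (a + v) * Gamma (b + v) * Gamma (p - v) * Gamma (q - v)) (1 - x)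
      = Gamma (a + p) * Gamma (b + p) * Gamma (a + q) * Gamma (b + q) *
        (((1 - x : ℝ) : ℂ) ^ a * regularizedGaussHGFun (a + p) (a + q) (a + b + p + q) x) := by
  have hw : 0 < 1 - x := by linarith
  set h : ℝ → ℂ := fun y => Gamma (b + q) * ((y : ℂ) ^ (q - 1) * (1 + y : ℂ) ^ (-(b + q))) with hh
  have hcongr : ∀ v : ℂ, ∀ y ∈ Set.Ioi (0 : ℝ), h y * (y : ℂ) ^ (-v) =
      Gamma (b + q) * ((y : ℂ) ^ (q - v - 1) * (1 + y : ℂ) ^ (-((q - v) + (b + v)))) := by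
    intro v y hy
    have : (y : ℂ) ≠ 0 := Complex.ofReal_ne_zero.2 (ne_of_gt hy)
    rw [show q - v - 1 = (q - 1) + -v by ring, Complex.cpow_add _ _ this,
      show (q - v) + (b + v) = b + q by ring]
    simp only [hh]; ring
  have hG : Gamma (b + q) ≠ 0 := Complex.Gamma_ne_zero_of_re_pos (by simp; linarith)
  have hM₂ : ∀ v : ℂ, v.re = σ → Gamma (b + v) * Gamma (q - v)
      = ∫ y in Set.Ioi (0 : ℝ), h y * ((id y : ℝ) : ℂ) ^ (-v) := by
    intro v hv
    simp only [id]
    rw [setIntegral_congr_fun measurableSet_Ioi (hcongr v), integral_const_mul,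
      integral_beta_prime (by simpa [hv] using hq) (by simpa [hv] using hb),
      show q - v + (b + v) = b + q by ring]
    field_simp
  have hint : IntegrableOn (fun y => h y * ((id y : ℝ) : ℂ) ^ (-(σ : ℂ))) (Set.Ioi 0) := by
    refine (integrableOn_congr_fun (hcongr σ) measurableSet_Ioi).2 ?_
    exact (integrableOn_beta_prime (by simpa using hq) (by simpa using hb)).const_mul _
  have hF := mellinInv_mul_integral measurableSet_Ioi measurable_id (fun y hy => hy)
    (verticalIntegrable_Gamma_mul_Gamma ha hp) hint hM₂ hw
  rw [mellinInv_congr (g := fun v => Gamma (a + v) * Gamma (p - v) *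
    (Gamma (b + v) * Gamma (q - v))) (fun v _ => by ring), hF, integral_Ioi_eq_integral_Ioo]
  have hE := integral_euler (A := a + p) (B := a + q) (C := a + b + p + q) (x := x)
    (by simp; linarith) (by simp; linarith) hx.le hx1
  rw [intervalIntegral.integral_of_le zero_le_one, integral_Ioc_eq_integral_Ioo,
    show a + b + p + q - (a + q) = b + p by ring] at hE
  have hR : Gamma (a + p) * Gamma (b + p) * Gamma (a + q) * Gamma (b + q) *
        (((1 - x : ℝ) : ℂ) ^ a * regularizedGaussHGFun (a + p) (a + q) (a + b + p + q) x)
      = Gamma (b + q) * Gamma (a + p) * ((1 - x : ℝ) : ℂ) ^ a *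
        (Gamma (a + q) * Gamma (b + p) *
          regularizedGaussHGFun (a + p) (a + q) (a + b + p + q) x) := by ring
  rw [hR, ← hE, ← integral_const_mul]
  refine setIntegral_congr_fun measurableSet_Ioo fun r hr => ?_
  have hr0 := hr.1
  have h1 : 0 < 1 - r := by linarith [hr.2]
  have h2 : 0 < 1 - r * x := by nlinarith [hr.1, hr.2]
  have hy : 0 < r / (1 - r) := div_pos hr0 h1
  simp only [id]
  rw [mellinInv_Gamma_mul_Gamma ha hp (mul_pos hw hy)]
  simp only [hh]
  have e1 : (1 + ((r / (1 - r) : ℝ) : ℂ)) = (((1 - r)⁻¹ : ℝ) : ℂ) := by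
    rw [← Complex.ofReal_one, ← Complex.ofReal_add]; congr 1; field_simp; ring
  have e2 : (1 - r : ℂ) = ((1 - r : ℝ) : ℂ) := by push_cast; ring
  have e3 : (1 - r * x : ℂ) = ((1 - r * x : ℝ) : ℂ) := by push_cast; ring
  -- After y = r/(1-r), the kernel 1 + (1-x)y produces the factor 1 - rx of Euler's integral. This
  -- is why an inversion at 1-x yields a hypergeometric function of x.
  have e4 : (1 + (((1 - x) * (r / (1 - r)) : ℝ) : ℂ)) = (((1 - r * x) / (1 - r) : ℝ) : ℂ) := by
    rw [← Complex.ofReal_one, ← Complex.ofReal_add]; congr 1; field_simp; ring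
  rw [e1, e2, e3, e4, ofReal_cpow_eq_exp hy, ofReal_cpow_eq_exp (inv_pos.2 h1),
    ofReal_cpow_eq_exp (mul_pos hw hy), ofReal_cpow_eq_exp (div_pos h2 h1),
    ofReal_cpow_eq_exp hw, ofReal_cpow_eq_exp hr0, ofReal_cpow_eq_exp h1, ofReal_cpow_eq_exp h2,
    Real.log_mul hw.ne' hy.ne', Real.log_div hr0.ne' h1.ne', Real.log_div h2.ne' h1.ne',
    Real.log_inv, Complex.real_smul, inv_sq_eq_exp h1]
  have key : ∀ X Y A₁ A₂ A₃ A₄ A₅ B₁ B₂ B₃ B₄ : ℂ, A₁ + (A₂ + A₃) + (A₄ + A₅)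
      = B₁ + (B₂ + B₃ + B₄) →
      cexp A₁ * (X * (cexp A₂ * cexp A₃) * (Y * (cexp A₄ * cexp A₅)))
        = X * Y * cexp B₁ * (cexp B₂ * cexp B₃ * cexp B₄) := by
    intro X Y A₁ A₂ A₃ A₄ A₅ B₁ B₂ B₃ B₄ hAB
    have : cexp (A₁ + (A₂ + A₃) + (A₄ + A₅)) = cexp (B₁ + (B₂ + B₃ + B₄)) := by rw [hAB]
    simp only [Complex.exp_add] at this
    linear_combination X * Y * this
  apply key
  push_cast
  ring

/-- Comparison of coefficients. The second series carries an extra z, so the constant terms are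
split off and compared separately. The relation mirrors the recurrence in c of the three-Gamma
Barnes integral. -/
lemma regularizedGaussHGFun_contiguous (A D E : ℂ) {z : ℂ} (hz : ‖z‖ < 1) :
    regularizedGaussHGFun A D E z = E * regularizedGaussHGFun A (D + 1) (E + 1) z
      - A * (E - D) * z * regularizedGaussHGFun (A + 1) (D + 1) (E + 2) z := by
  have h1 := (hasSum_nat_add_iff' 1).2 (hasSum_regularizedGaussHGFun A D E hz)
  have h2 := (hasSum_nat_add_iff' 1).2 (hasSum_regularizedGaussHGFun A (D + 1) (E + 1) hz)
  have h3 := hasSum_regularizedGaussHGFun (A + 1) (D + 1) (E + 2) hz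
  have h4 := (h2.mul_left E).sub (h3.mul_left (A * (E - D) * z))
  have h5 := h4.unique (h1.congr_fun fun n => ?_)
  · simp only [Finset.range_one, Finset.sum_singleton, ascPochhammer_zero, Polynomial.eval_one,
      Nat.factorial_zero, Nat.cast_one, Nat.cast_zero, add_zero, pow_zero, mul_one, one_mul] at h5
    have h6 := Complex.one_div_Gamma_eq_self_mul_one_div_Gamma_add_one E
    rw [one_div, one_div, h6] at h5
    linear_combination -h5
  · have e1 := ascPochhammer_eval_add_one_mul A n
    have e2 := ascPochhammer_eval_add_one_mul D n
    have h6 := Complex.one_div_Gamma_eq_self_mul_one_div_Gamma_add_one (E + (n + 1 : ℕ))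
    have g1 : E + (n + 1 : ℕ) + 1 = E + 2 + n := by push_cast; ring
    have g2 : E + 1 + (n + 1 : ℕ) = E + 2 + n := by push_cast; ring
    rw [g1] at h6
    rw [g2]
    have hf : ((n : ℂ) + 1) ≠ 0 := by exact_mod_cast Nat.succ_ne_zero n
    have hf' : (n.factorial : ℂ) ≠ 0 := by exact_mod_cast n.factorial_ne_zero
    simp only [div_eq_mul_inv, mul_inv]
    rw [h6]
    simp only [ascPochhammer_succ_eval, Nat.factorial_succ, Nat.cast_mul, mul_inv, pow_succ]
    push_cast
    have e1' : (ascPochhammer ℂ n).eval A * (A + n) = A * (ascPochhammer ℂ n).eval (A + 1) := by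
      rw [← e1]; ring
    have e2' : (ascPochhammer ℂ n).eval D * (D + n) = D * (ascPochhammer ℂ n).eval (D + 1) := by
      rw [← e2]; ring
    rw [e1', e2']
    field_simp
    ring

lemma mellinInv_barnes_three_base {a b u c : ℂ} {σ : ℝ} (ha : 0 < a.re + σ)
    (hb : 0 < b.re + σ) (hu : 0 < u.re - σ) (hc : 0 < (c - b).re) {x : ℝ} (hx : 1 < x) :
    mellinInv σ (fun v => Gamma (a + v) * Gamma (b + v) * Gamma (u - v) / Gamma (c + v)) (x - 1)
      = Gamma (a + u) * Gamma (b + u) * (((x - 1 : ℝ) : ℂ) ^ a * (x : ℂ) ^ (-(a + u))) *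
        regularizedGaussHGFun (a + u) (c - b) (c + u) (x⁻¹ : ℝ) := by
  have hw : 0 < x - 1 := by linarith
  have hx0 : 0 < x := by linarith
  have hG : Gamma (c - b) ≠ 0 := Complex.Gamma_ne_zero_of_re_pos hc
  set h : ℝ → ℂ := fun r => (Gamma (c - b))⁻¹ * ((r : ℂ) ^ (b - 1) * (1 - r : ℂ) ^ (c - b - 1))
    with hh
  have hcongr : ∀ v : ℂ, ∀ r ∈ Set.Ioo (0 : ℝ) 1, h r * ((r⁻¹ : ℝ) : ℂ) ^ (-v) =
      (Gamma (c - b))⁻¹ * ((r : ℂ) ^ (b + v - 1) * (1 - r : ℂ) ^ (c - b - 1)) := by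
    intro v r hr
    have hr0 : (r : ℂ) ≠ 0 := Complex.ofReal_ne_zero.2 hr.1.ne'
    have : ((r⁻¹ : ℝ) : ℂ) ^ (-v) = (r : ℂ) ^ v := by
      rw [ofReal_cpow_eq_exp (inv_pos.2 hr.1), ofReal_cpow_eq_exp hr.1, Real.log_inv]
      push_cast; ring_nf
    rw [show b + v - 1 = (b - 1) + v by ring, Complex.cpow_add _ _ hr0, this]
    simp only [hh]; ring
  have hM₂ : ∀ v : ℂ, v.re = σ → Gamma (b + v) / Gamma (c + v)
      = ∫ r in Set.Ioo (0 : ℝ) 1, h r * ((r⁻¹ : ℝ) : ℂ) ^ (-v) := by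
    intro v hv
    rw [setIntegral_congr_fun measurableSet_Ioo (hcongr v), integral_const_mul,
      integral_beta (by simpa [hv] using hb) hc, show b + v + (c - b) = c + v by ring]
    field_simp
  have hint : IntegrableOn (fun r => h r * ((r⁻¹ : ℝ) : ℂ) ^ (-(σ : ℂ))) (Set.Ioo 0 1) := by
    refine (integrableOn_congr_fun (hcongr σ) measurableSet_Ioo).2 ?_
    exact (integrableOn_beta (by simpa using hb) hc).const_mul _
  have hF := mellinInv_mul_integral measurableSet_Ioo measurable_inv (fun r hr => inv_pos.2 hr.1)
    (verticalIntegrable_Gamma_mul_Gamma ha hu) hint hM₂ hw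
  rw [mellinInv_congr (g := fun v => Gamma (a + v) * Gamma (u - v) *
    (Gamma (b + v) / Gamma (c + v))) (fun v _ => by ring), hF]
  have hE := integral_euler (A := a + u) (B := c - b) (C := c + u) (x := x⁻¹)
    hc (by simp; linarith) (by positivity) (inv_lt_one_of_one_lt₀ hx)
  -- Euler's integral is reflected by r ↦ 1-r: its factor becomes 1 - (1-r)/x = (x-1+r)/x, matching
  -- the kernel 1 + (x-1)/r = (x-1+r)/r.
  have hsub := intervalIntegral.integral_comp_sub_left (a := 0) (b := 1)
    (fun r : ℝ => (r : ℂ) ^ (c - b - 1) * (1 - r : ℂ) ^ (c + u - (c - b) - 1) *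
      (1 - r * (x⁻¹ : ℝ) : ℂ) ^ (-(a + u))) (1 : ℝ)
  rw [sub_self, sub_zero] at hsub
  rw [← hsub, intervalIntegral.integral_of_le zero_le_one, integral_Ioc_eq_integral_Ioo,
    show c + u - (c - b) = b + u by ring] at hE
  have hR : Gamma (a + u) * Gamma (b + u) * (((x - 1 : ℝ) : ℂ) ^ a * (x : ℂ) ^ (-(a + u))) *
        regularizedGaussHGFun (a + u) (c - b) (c + u) (x⁻¹ : ℝ)
      = (Gamma (c - b))⁻¹ * Gamma (a + u) * (((x - 1 : ℝ) : ℂ) ^ a * (x : ℂ) ^ (-(a + u))) *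
        (Gamma (c - b) * Gamma (b + u) *
          regularizedGaussHGFun (a + u) (c - b) (c + u) (x⁻¹ : ℝ)) := by field_simp
  rw [hR, ← hE, ← integral_const_mul]
  refine setIntegral_congr_fun measurableSet_Ioo fun r hr => ?_
  have hr0 := hr.1
  have h1 : 0 < 1 - r := by linarith [hr.2]
  have h2 : 0 < (x - 1 + r) / x := by positivity
  have hy : 0 < (x - 1) * r⁻¹ := by positivity
  have h3 : 0 < x - 1 + r := by positivity
  rw [mellinInv_Gamma_mul_Gamma ha hu hy]
  simp only [hh]
  have e2 : (1 - r : ℂ) = ((1 - r : ℝ) : ℂ) := by push_cast; ring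
  have e3 : (1 - ((1 - r : ℝ) : ℂ) * ((x⁻¹ : ℝ) : ℂ)) = (((x - 1 + r) / x : ℝ) : ℂ) := by
    rw [← Complex.ofReal_one, ← Complex.ofReal_mul, ← Complex.ofReal_sub]; congr 1
    field_simp; ring
  have e4 : (1 + (((x - 1) * r⁻¹ : ℝ) : ℂ)) = (((x - 1 + r) / r : ℝ) : ℂ) := by
    rw [← Complex.ofReal_one, ← Complex.ofReal_add]; congr 1; field_simp; ring
  have e5 : (1 - ((1 - r : ℝ) : ℂ)) = (r : ℂ) := by push_cast; ring
  rw [e3, e4, e5, e2, ofReal_cpow_eq_exp hy, ofReal_cpow_eq_exp (div_pos h3 hr0),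
    ofReal_cpow_eq_exp hw, ofReal_cpow_eq_exp hr0, ofReal_cpow_eq_exp h1, ofReal_cpow_eq_exp h2,
    ofReal_cpow_eq_exp hx0, ofReal_cpow_eq_exp hr0,
    Real.log_mul hw.ne' (inv_pos.2 hr0).ne', Real.log_div h3.ne' hr0.ne',
    Real.log_div h3.ne' hx0.ne', Real.log_inv]
  have key : ∀ X Y A₁ A₂ A₃ A₄ B₁ B₂ B₃ B₄ B₅ : ℂ, A₁ + A₂ + (A₃ + A₄)
      = B₁ + B₂ + (B₃ + B₄ + B₅) →
      X * (cexp A₁ * cexp A₂) * (Y * (cexp A₃ * cexp A₄))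
        = X * Y * (cexp B₁ * cexp B₂) * (cexp B₃ * cexp B₄ * cexp B₅) := by
    intro X Y A₁ A₂ A₃ A₄ B₁ B₂ B₃ B₄ B₅ hAB
    have : cexp (A₁ + A₂ + (A₃ + A₄)) = cexp (B₁ + B₂ + (B₃ + B₄ + B₅)) := by rw [hAB]
    simp only [Complex.exp_add] at this
    linear_combination X * Y * this
  apply key
  push_cast
  ring

/-- The Mellin-Barnes integral with three Gamma functions in the numerator. -/
theorem mellinInv_barnes_three {a b u c : ℂ} {σ : ℝ} (ha : 0 < a.re + σ)
    (hb : 0 < b.re + σ) (hu : 0 < u.re - σ) {x : ℝ} (hx : 1 < x) :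
    mellinInv σ (fun v => Gamma (a + v) * Gamma (b + v) * Gamma (u - v) / Gamma (c + v)) (x - 1)
      = Gamma (a + u) * Gamma (b + u) * (((x - 1 : ℝ) : ℂ) ^ a * (x : ℂ) ^ (-(a + u))) *
        regularizedGaussHGFun (a + u) (c - b) (c + u) (x⁻¹ : ℝ) := by
  have key : ∀ N : ℕ, ∀ u c : ℂ, 0 < u.re - σ → 0 < (c - b).re + N →
      mellinInv σ (fun v => Gamma (a + v) * Gamma (b + v) * Gamma (u - v) / Gamma (c + v)) (x - 1)
      = Gamma (a + u) * Gamma (b + u) * (((x - 1 : ℝ) : ℂ) ^ a * (x : ℂ) ^ (-(a + u))) *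
        regularizedGaussHGFun (a + u) (c - b) (c + u) (x⁻¹ : ℝ) := by
    intro N
    induction N with
    | zero =>
      intro u c hu hc
      exact mellinInv_barnes_three_base ha hb hu (by simpa using hc) hx
    | succ N ih =>
      intro u c hu hc
      have hu1 : 0 < (u + 1).re - σ := by simp only [add_re, one_re]; linarith
      have hc1 : 0 < (c + 1 - b).re + N := by
        push_cast at hc; simp only [add_re, sub_re, one_re] at hc ⊢; linarith
      have hx0 : (x : ℂ) ≠ 0 := Complex.ofReal_ne_zero.2 (by linarith)
      -- Raising c brings in c + v = (c+u) - (u-v), and u - v is absorbed into Γ(u+1-v). Both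
      -- resulting integrals have c + 1 in place of c, one of them also u + 1 in place of u.
      rw [mellinInv_congr (g := fun v => (c + u) * (Gamma (a + v) * Gamma (b + v) * Gamma (u - v)
        / Gamma (c + 1 + v)) + -1 * (Gamma (a + v) * Gamma (b + v) * Gamma (u + 1 - v)
        / Gamma (c + 1 + v))), mellinInv_add
          (verticalIntegrable_const_mul (verticalIntegrable_barnes_three ha hb hu) _)
          (verticalIntegrable_const_mul (verticalIntegrable_barnes_three ha hb hu1) _)
          (by linarith), mellinInv_const_mul, mellinInv_const_mul, ih u (c + 1) hu hc1,
          ih (u + 1) (c + 1) hu1 hc1]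
      · have hz : ‖((x⁻¹ : ℝ) : ℂ)‖ < 1 := by
          rw [Complex.norm_real, Real.norm_of_nonneg (by positivity)]
          exact inv_lt_one_of_one_lt₀ hx
        have hau : a + u ≠ 0 := by
          intro h
          have := congrArg Complex.re h
          simp at this
          linarith
        have hbu : b + u ≠ 0 := by
          intro h
          have := congrArg Complex.re h
          simp at this
          linarith
        rw [regularizedGaussHGFun_contiguous (a + u) (c - b) (c + u) hz, show a + (u + 1) = a + u + 1 by ring,
          show b + (u + 1) = b + u + 1 by ring, Complex.Gamma_add_one _ hau,
          Complex.Gamma_add_one _ hbu, show c + 1 - b = c - b + 1 by ring,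
          show c + 1 + u = c + u + 1 by ring, show c + 1 + (u + 1) = c + u + 2 by ring,
          show -(a + u + 1) = -(a + u) - 1 by ring, Complex.cpow_sub _ _ hx0, Complex.cpow_one]
        push_cast
        ring
      · intro v hv
        have huv : u - v ≠ 0 := by
          intro h
          have := congrArg Complex.re h
          simp [hv] at this
          linarith
        have h1 := Complex.one_div_Gamma_eq_self_mul_one_div_Gamma_add_one (c + v)
        rw [show c + v + 1 = c + 1 + v by ring] at h1
        rw [show u + 1 - v = u - v + 1 by ring, Complex.Gamma_add_one _ huv]
        simp only [div_eq_mul_inv]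
        rw [h1]
        ring
  obtain ⟨N, hN⟩ := exists_nat_gt (-(c - b).re)
  exact key N u c hu (by linarith)

/-! ### Holomorphy of the hypergeometric function in its parameters. -/

lemma norm_ascPochhammer_eval_le {a : ℂ} {R : ℝ} (ha : ‖a‖ ≤ R) (n : ℕ) :
    ‖(ascPochhammer ℂ n).eval a‖ ≤ (ascPochhammer ℝ n).eval R := by
  have hR : 0 ≤ R := (norm_nonneg a).trans ha
  induction n with
  | zero => simp
  | succ n ih =>
    rw [ascPochhammer_succ_eval, ascPochhammer_succ_eval, norm_mul]
    have h : ‖a + n‖ ≤ R + n := (norm_add_le _ _).trans (by simpa using ha)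
    gcongr
    exact (norm_nonneg _).trans ih

/-- A summable majorant for the hypergeometric series, uniform for bounded parameters. -/
lemma exists_summable_hypergeometric_bound {R : ℝ} (hR : 0 ≤ R) {z : ℂ} (hz : ‖z‖ < 1) :
    ∃ T : ℕ → ℝ, Summable T ∧ ∀ a b c : ℂ, ‖a‖ ≤ R → ‖b‖ ≤ R → ‖c‖ ≤ R → ∀ n : ℕ,
      ‖(ascPochhammer ℂ n).eval a * (ascPochhammer ℂ n).eval b /
        (n.factorial * Gamma (c + n)) * z ^ n‖ ≤ T n := by
  have hmax : ∀ n : ℕ, ∃ w ∈ Metric.closedBall (0 : ℂ) R, ∀ c ∈ Metric.closedBall (0 : ℂ) R,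
      ‖(Gamma (c + n))⁻¹‖ ≤ ‖(Gamma (w + n))⁻¹‖ := by
    intro n
    obtain ⟨w, hw, hm⟩ := (isCompact_closedBall (0 : ℂ) R).exists_isMaxOn
      (f := fun c : ℂ => ‖(Gamma (c + n))⁻¹‖) ⟨0, by simpa using hR⟩
      (continuous_inv_Gamma (by fun_prop)).norm.continuousOn
    exact ⟨w, hw, fun c hc => hm hc⟩
  choose w hw hm using hmax
  -- D n is the maximum of 1/|Γ(c+n)| over the ball of radius R. Since |c+n| ≥ n-R, the functional
  -- equation gives D(n+1) ≤ D(n)/(n-R), and the ratio of consecutive majorants tends to |z| < 1.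
  set D : ℕ → ℝ := fun n => ‖(Gamma (w n + n))⁻¹‖ with hD
  have hDrec : ∀ n : ℕ, R < n → D (n + 1) ≤ D n / (n - R) := by
    intro n hn
    have h1 := Complex.one_div_Gamma_eq_self_mul_one_div_Gamma_add_one (w (n + 1) + n)
    have hwn : ‖w (n + 1)‖ ≤ R := by simpa using hw (n + 1)
    have h2 : (n : ℝ) - R ≤ ‖w (n + 1) + n‖ := by
      have := norm_sub_norm_le (n : ℂ) (-w (n + 1))
      rw [norm_neg, sub_neg_eq_add, Complex.norm_natCast, add_comm (n : ℂ)] at this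
      linarith
    rw [le_div_iff₀ (by linarith)]
    calc D (n + 1) * (n - R) ≤ D (n + 1) * ‖w (n + 1) + n‖ := by
          gcongr
      _ = ‖(Gamma (w (n + 1) + n))⁻¹‖ := by
          rw [h1, norm_mul, mul_comm, hD]
          simp only [Nat.cast_add, Nat.cast_one, add_assoc]
      _ ≤ D n := hm n _ (hw (n + 1))
  have hD0 : ∀ n, 0 ≤ D n := fun n => norm_nonneg _
  set P : ℕ → ℝ := fun n => (ascPochhammer ℝ n).eval R with hP
  have hP0 : ∀ n, 0 ≤ P n := fun n =>
    (norm_nonneg _).trans (norm_ascPochhammer_eval_le (a := 0) (by simpa using hR) n)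
  set ρ := ‖z‖ with hρ
  have hρ0 : 0 ≤ ρ := norm_nonneg z
  refine ⟨fun n => P n * P n / n.factorial * D n * ρ ^ n, ?_, ?_⟩
  · have hlim : Tendsto (fun n : ℕ => (R + 1 * n) / (1 + 1 * n) * ((R + 1 * n) / (-R + 1 * n)) * ρ)
        atTop (𝓝 (1 / 1 * (1 / 1) * ρ)) :=
      ((tendsto_add_mul_div_add_mul_atTop_nhds R 1 1 one_ne_zero).mul
        (tendsto_add_mul_div_add_mul_atTop_nhds R (-R) 1 one_ne_zero)).mul_const ρ
    have hlt : 1 / 1 * (1 / 1) * ρ < (1 + ρ) / 2 := by linarith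
    refine summable_of_ratio_norm_eventually_le (r := (1 + ρ) / 2) (by linarith) ?_
    filter_upwards [hlim.eventually_lt_const hlt, eventually_gt_atTop ⌈R⌉₊] with n hn hRn
    have hRn' : R < n := (Nat.le_ceil R).trans_lt (by exact_mod_cast hRn)
    have hnR : 0 < (n : ℝ) - R := by linarith
    have hT0 : ∀ n : ℕ, 0 ≤ P n * P n / n.factorial * D n * ρ ^ n := fun n => by
      have := hP0 n; have := hD0 n; positivity
    rw [Real.norm_of_nonneg (hT0 _), Real.norm_of_nonneg (hT0 _)]
    have hPs : P (n + 1) = P n * (R + n) := by simp only [hP, ascPochhammer_succ_eval]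
    have hPn := hP0 n
    have hDn := hD0 n
    calc P (n + 1) * P (n + 1) / (n + 1).factorial * D (n + 1) * ρ ^ (n + 1)
        ≤ P (n + 1) * P (n + 1) / (n + 1).factorial * (D n / (n - R)) * ρ ^ (n + 1) := by
          have := hP0 (n + 1)
          gcongr
          exact hDrec n hRn'
      _ = (R + 1 * n) / (1 + 1 * n) * ((R + 1 * n) / (-R + 1 * n)) * ρ *
          (P n * P n / n.factorial * D n * ρ ^ n) := by
          rw [hPs, Nat.factorial_succ, pow_succ, show -R + 1 * (n : ℝ) = n - R by ring]
          have h1 : (0 : ℝ) < n + 1 := by positivity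
          have h2 : (1 + 1 * (n : ℝ)) = n + 1 := by ring
          rw [h2]
          push_cast
          field_simp
      _ ≤ (1 + ρ) / 2 * (P n * P n / n.factorial * D n * ρ ^ n) := by
          have := hT0 n
          gcongr
  · intro a b c ha hb hc n
    rw [norm_mul, norm_div, norm_mul, norm_mul, norm_pow, Complex.norm_natCast, ← div_div,
      div_eq_mul_inv _ ‖Gamma (c + n)‖, ← norm_inv]
    have := hP0 n
    change _ ≤ P n * P n / n.factorial * D n * ρ ^ n
    gcongr
    · exact norm_ascPochhammer_eval_le ha n
    · exact norm_ascPochhammer_eval_le hb n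
    · exact hm n c (by simpa using hc)

/-- Cauchy's estimate: a bound T n on the ball of radius 2 bounds the Fréchet derivative by 2 T n on
the ball of radius 1, so the series may be differentiated term by term. -/
lemma differentiable_tsum_of_locally_bounded {f : ℕ → ℂ × ℂ → ℂ}
    (hf : ∀ n, Differentiable ℂ (f n))
    (hb : ∀ p₀ : ℂ × ℂ, ∃ T : ℕ → ℝ, Summable T ∧ ∀ n, ∀ p ∈ Metric.ball p₀ 2, ‖f n p‖ ≤ T n) :
    Differentiable ℂ fun p => ∑' n, f n p := by
  intro p₀
  obtain ⟨T, hT, hle⟩ := hb p₀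
  have hp₀ : p₀ ∈ Metric.ball p₀ 1 := Metric.mem_ball_self one_pos
  refine (hasFDerivAt_tsum_of_isPreconnected (u := fun n => 2 * T n / 1) (s := Metric.ball p₀ 1)
    (f' := fun n p => fderiv ℂ (f n) p) ((hT.mul_left 2).div_const 1)
    Metric.isOpen_ball (convex_ball p₀ 1).isPreconnected
    (fun n p _ => (hf n p).hasFDerivAt) ?_ hp₀ ?_ hp₀).differentiableAt
  · intro n p hp
    have hsub : Metric.ball p 1 ⊆ Metric.ball p₀ 2 := by
      refine Metric.ball_subset_ball' ?_
      have := Metric.mem_ball.1 hp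
      linarith
    refine Complex.norm_fderiv_le_div_of_mapsTo_ball (hf n).differentiableOn ?_ one_pos
    intro q hq
    have h1 := hle n q (hsub hq)
    have h2 := hle n p (hsub (Metric.mem_ball_self one_pos))
    rw [Metric.mem_closedBall, dist_eq_norm]
    exact (norm_sub_le _ _).trans (by linarith)
  · refine Summable.of_norm_bounded hT fun n => hle n p₀ (Metric.mem_ball_self two_pos)

lemma differentiable_regularizedGaussHGFun {α β γ : ℂ × ℂ → ℂ} (hα : Differentiable ℂ α)
    (hβ : Differentiable ℂ β) (hγ : Differentiable ℂ γ) {z : ℂ} (hz : ‖z‖ < 1) :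
    Differentiable ℂ fun p => regularizedGaussHGFun (α p) (β p) (γ p) z := by
  simp_rw [regularizedGaussHGFun_eq_tsum]
  refine differentiable_tsum_of_locally_bounded (fun n => ?_) fun p₀ => ?_
  · simp_rw [div_eq_mul_inv, mul_inv]
    refine Differentiable.mul_const (Differentiable.mul (Differentiable.mul
      ((Polynomial.differentiable _).comp hα) ((Polynomial.differentiable _).comp hβ))
      (Differentiable.const_mul ?_ _)) _
    exact Complex.differentiable_one_div_Gamma.comp (hγ.add_const _)
  · have hbd : ∀ g : ℂ × ℂ → ℂ, Differentiable ℂ g →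
        ∃ R, ∀ p ∈ Metric.closedBall p₀ 2, ‖g p‖ ≤ R := fun g hg =>
      (isCompact_closedBall p₀ 2).exists_bound_of_continuousOn hg.continuous.continuousOn
    obtain ⟨R₁, h₁⟩ := hbd α hα
    obtain ⟨R₂, h₂⟩ := hbd β hβ
    obtain ⟨R₃, h₃⟩ := hbd γ hγ
    obtain ⟨T, hT, hle⟩ := exists_summable_hypergeometric_bound
      (R := max 0 (max R₁ (max R₂ R₃))) (le_max_left _ _) hz
    refine ⟨T, hT, fun n p hp => ?_⟩
    have hp' := Metric.ball_subset_closedBall hp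
    exact hle _ _ _ ((h₁ p hp').trans (by simp)) ((h₂ p hp').trans (by simp))
      ((h₃ p hp').trans (by simp)) n

/-! ### The reflection formula, and the passage from vertical integrals to Mellin inversion. -/

lemma inv_Gamma_eq_sin_mul_Gamma {z : ℂ} (hz : NotGammaPole (1 - z)) :
    Complex.sin (Real.pi * z) / Real.pi * Gamma (1 - z) = (Gamma z)⁻¹ := by
  have h := Complex.Gamma_mul_Gamma_one_sub z
  have h1 : Gamma (1 - z) ≠ 0 := Complex.Gamma_ne_zero hz
  have hpi : (Real.pi : ℂ) ≠ 0 := Complex.ofReal_ne_zero.2 Real.pi_ne_zero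
  -- When the sine vanishes, the reflection formula reads Γ(z)Γ(1-z) = π/0 = 0. As Γ(1-z) ≠ 0, this
  -- forces the default value Γ(z) = 0, whose inverse is 0.
  by_cases hs : Complex.sin (Real.pi * z) = 0
  · rw [hs, div_zero, mul_eq_zero] at h
    rw [hs, h.resolve_right h1]
    simp
  · have hG : Gamma z ≠ 0 := by
      intro h0
      rw [h0, zero_mul, eq_comm, div_eq_zero_iff] at h
      tauto
    rw [eq_div_iff hs] at h
    field_simp
    linear_combination h

lemma norm_mellinInv_le (σ : ℝ) (M : ℂ → ℂ) {z : ℝ} (hz : 0 < z) :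
    ‖mellinInv σ M z‖ ≤ z ^ (-σ) * (1 / (2 * Real.pi) * ∫ t : ℝ, ‖M (σ + t * I)‖) := by
  unfold mellinInv
  rw [norm_smul, Real.norm_of_nonneg (by positivity), mul_left_comm]
  gcongr
  refine (norm_integral_le_integral_norm _).trans (le_of_eq ?_)
  rw [← integral_const_mul]
  congr 1
  ext t
  rw [norm_smul, Complex.norm_cpow_eq_rpow_re_of_pos hz]
  simp

lemma verticalIntegral_eq_mellinInv {σ : ℝ} {f M : ℂ → ℂ} {w : ℝ}
    (h : ∀ v, f v = M v * (w : ℂ) ^ (-v)) : verticalIntegral σ f = mellinInv σ M w := by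
  have hpi : (Real.pi : ℂ) ≠ 0 := Complex.ofReal_ne_zero.2 Real.pi_ne_zero
  unfold verticalIntegral mellinInv
  rw [integral_mul_const, Complex.real_smul]
  have : ∫ t : ℝ, f (σ + t * I) = ∫ t : ℝ, (w : ℂ) ^ (-(σ + t * I)) • M (σ + t * I) := by
    congr 1
    ext t
    rw [h, smul_eq_mul, mul_comm]
  rw [this]
  push_cast
  field_simp [Complex.I_ne_zero]

lemma verticalIntegrable_mul_cpow {σ : ℝ} {f M : ℂ → ℂ} {w : ℝ} (hw : 0 < w)
    (hM : VerticalIntegrable M σ) (h : ∀ v, f v = M v * (w : ℂ) ^ (-v)) :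
    VerticalIntegrable f σ := by
  have h1 : Integrable (fun t : ℝ => (w : ℂ) ^ (-(σ + t * I)) * M (σ + t * I)) := by
    refine Integrable.bdd_mul (c := w ^ (-σ)) hM ?_ (Eventually.of_forall fun t => ?_)
    · have := (continuous_cpow_vertical hw 0 σ).aestronglyMeasurable (μ := volume)
      simpa only [zero_sub] using this
    · rw [Complex.norm_cpow_eq_rpow_re_of_pos hw]
      simp
  refine h1.congr (Eventually.of_forall fun t => ?_)
  simp only [h]
  ring

/-! ### F₂ and its meromorphic continuation. -/

lemma weightShift_eq_ofReal (k : ℕ) : weightShift k = ((((k : ℝ) - 1) / 2 : ℝ) : ℂ) := by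
  simp [weightShift]

lemma weightShift_re (k : ℕ) : (weightShift k).re = ((k : ℝ) - 1) / 2 := by
  rw [weightShift_eq_ofReal, Complex.ofReal_re]

lemma weightShift_im (k : ℕ) : (weightShift k).im = 0 := by
  rw [weightShift_eq_ofReal, Complex.ofReal_im]

lemma F2Integrand_eq_gammaQuotient (s u : ℂ) (k : ℕ) {x : ℝ} (hx : 0 < x) (v : ℂ) :
    F2Integrand s u k x v = gammaQuotient u (1 - s + weightShift k) (s + weightShift k) (1 + u) v
      * ((x⁻¹ : ℝ) : ℂ) ^ (-v) := by
  have h : ((x⁻¹ : ℝ) : ℂ) ^ (-v) = (x : ℂ) ^ v := by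
    rw [ofReal_cpow_eq_exp (inv_pos.2 hx), ofReal_cpow_eq_exp hx, Real.log_inv]
    push_cast; ring_nf
  rw [h, F2Integrand, gammaQuotient, show 1 - s - v + weightShift k = 1 - s + weightShift k - v by
    ring, show s + v + weightShift k = s + weightShift k + v by ring]
  simp only [div_eq_mul_inv]
  ring

/-- The entire factor of the meromorphic continuation of `F₂(s, u, k; x)`. -/
noncomputable def F2EntireFactor (k : ℕ) (x : ℝ) (p : ℂ × ℂ) : ℂ :=
  if 1 < x then
    -I ^ k * ((Gamma (p.1 - p.2 + weightShift k))⁻¹ * (x : ℂ) ^ (-p.2) *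
      regularizedGaussHGFun (1 - p.1 + p.2 + weightShift k) (1 - p.1 + p.2 - weightShift k)
        (1 + 2 * p.2) (x⁻¹ : ℝ))
  else if x = 1 then
    -I ^ k * ((Gamma (p.1 + p.2 - weightShift k))⁻¹ * (Gamma (p.1 + p.2 + weightShift k))⁻¹ *
      (Gamma (p.1 - p.2 + weightShift k))⁻¹)
  else
    -I ^ k * ((Gamma (p.1 + p.2 - weightShift k))⁻¹ * (x : ℂ) ^ (1 - p.1 + weightShift k) *
      regularizedGaussHGFun (1 - p.1 + p.2 + weightShift k) (1 - p.1 - p.2 + weightShift k)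
        k x)

/-- The entire denominator of the meromorphic continuation of `F₂(s, u, k; x)`. -/
noncomputable def F2Denominator (k : ℕ) (x : ℝ) (p : ℂ × ℂ) : ℂ :=
  (Gamma (1 - p.1 + p.2 + weightShift k))⁻¹ * (if x = 1 then (Gamma (2 * p.1 - 1))⁻¹ else 1)

/-- The meromorphic continuation of `F₂(s, u, k; x)`. -/
noncomputable def F2Continuation (k : ℕ) (x : ℝ) (s u : ℂ) : ℂ :=
  F2EntireFactor k x (s, u) / F2Denominator k x (s, u)

lemma differentiable_inv_Gamma_comp {g : ℂ × ℂ → ℂ} (hg : Differentiable ℂ g) :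
    Differentiable ℂ fun p => (Gamma (g p))⁻¹ :=
  Complex.differentiable_one_div_Gamma.comp hg

lemma differentiable_F2Denominator (k : ℕ) (x : ℝ) : Differentiable ℂ (F2Denominator k x) := by
  unfold F2Denominator
  refine (differentiable_inv_Gamma_comp (by fun_prop)).mul ?_
  by_cases h : x = 1
  · simp only [h, if_true]
    exact differentiable_inv_Gamma_comp (by fun_prop)
  · simp only [h, if_false]
    fun_prop

lemma differentiable_F2EntireFactor (k : ℕ) {x : ℝ} (hx : 0 < x) :
    Differentiable ℂ (F2EntireFactor k x) := by
  unfold F2EntireFactor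
  have hcp : ∀ g : ℂ × ℂ → ℂ, Differentiable ℂ g → Differentiable ℂ fun p => (x : ℂ) ^ g p :=
    fun g hg p => (hg p).const_cpow (Or.inl (Complex.ofReal_ne_zero.2 hx.ne'))
  by_cases h1 : 1 < x
  · simp only [h1, if_true]
    refine Differentiable.const_mul (((differentiable_inv_Gamma_comp (by fun_prop)).mul
      (hcp _ (by fun_prop))).mul (differentiable_regularizedGaussHGFun (by fun_prop) (by fun_prop)
      (by fun_prop) ?_)) _
    rw [Complex.norm_real, Real.norm_of_nonneg (by positivity)]
    exact inv_lt_one_of_one_lt₀ h1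
  · simp only [h1, if_false]
    by_cases h2 : x = 1
    · simp only [h2, if_true]
      exact Differentiable.const_mul (((differentiable_inv_Gamma_comp (by fun_prop)).mul
        (differentiable_inv_Gamma_comp (by fun_prop))).mul
        (differentiable_inv_Gamma_comp (by fun_prop))) _
    · simp only [h2, if_false]
      refine Differentiable.const_mul (((differentiable_inv_Gamma_comp (by fun_prop)).mul
        (hcp _ (by fun_prop))).mul (differentiable_regularizedGaussHGFun (by fun_prop)
        (by fun_prop) (by fun_prop) ?_)) _
      rw [Complex.norm_real, Real.norm_of_nonneg hx.le]
      exact lt_of_le_of_ne (not_lt.1 h1) h2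

lemma eventually_add_two_mul_ne_zero (c : ℝ) : ∀ᶠ δ : ℝ in 𝓝[>] 0, c + 2 * δ ≠ 0 := by
  by_cases hc : c = 0
  · filter_upwards [self_mem_nhdsWithin] with δ hδ
    have : 0 < δ := hδ
    rw [hc]
    positivity
  · have h : ContinuousAt (fun δ : ℝ => c + 2 * δ) 0 := by fun_prop
    exact nhdsWithin_le_nhds (h.eventually_ne (by simpa using hc))

lemma notGammaPole_of_im_ne_zero {z : ℂ} (hz : z.im ≠ 0) : NotGammaPole z := by
  intro m h
  rw [h] at hz
  simp at hz

lemma F2Denominator_ne_zero {k : ℕ} {x : ℝ} {s u : ℂ}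
    (h1 : NotGammaPole (1 - s + u + weightShift k)) (h2 : x = 1 → NotGammaPole (2 * s - 1)) :
    F2Denominator k x (s, u) ≠ 0 := by
  unfold F2Denominator
  refine mul_ne_zero (inv_ne_zero (Complex.Gamma_ne_zero h1)) ?_
  split_ifs with h
  · exact inv_ne_zero (Complex.Gamma_ne_zero (h2 h))
  · exact one_ne_zero

lemma mem_closure_F2Denominator_ne_zero (k : ℕ) (x : ℝ) (p : ℂ × ℂ) :
    p ∈ closure {q | F2Denominator k x q ≠ 0} := by
  -- The slopes 1 and 3 make the imaginary parts of both u - s and 2s move by 2δ. For small δ > 0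
  -- both Gamma arguments are then non-real, hence not poles.
  have hc : ContinuousAt (fun δ : ℝ => ((p.1 + δ * I, p.2 + 3 * δ * I) : ℂ × ℂ)) 0 := by fun_prop
  have ht : Tendsto (fun δ : ℝ => ((p.1 + δ * I, p.2 + 3 * δ * I) : ℂ × ℂ)) (𝓝[>] 0) (𝓝 p) := by
    have := hc.tendsto.mono_left (nhdsWithin_le_nhds (s := Set.Ioi 0))
    simpa using this
  refine mem_closure_of_tendsto ht ?_
  filter_upwards [eventually_add_two_mul_ne_zero (p.2.im - p.1.im),
    eventually_add_two_mul_ne_zero (2 * p.1.im)] with δ h1 h2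
  refine F2Denominator_ne_zero (notGammaPole_of_im_ne_zero ?_)
    fun _ => notGammaPole_of_im_ne_zero ?_
  · intro h
    apply h1
    simp [weightShift_im] at h
    linarith
  · intro h
    apply h2
    simp at h
    linarith

lemma meromorphicOnC2_F2Continuation (k : ℕ) {x : ℝ} (hx : 0 < x) :
    MeromorphicOnC2 (fun p => F2Continuation k x p.1 p.2) := fun p =>
  ⟨Set.univ, F2EntireFactor k x, F2Denominator k x, isOpen_univ, Set.mem_univ p,
    (differentiable_F2EntireFactor k hx).differentiableOn,
    (differentiable_F2Denominator k x).differentiableOn,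
    fun q _ => mem_closure_F2Denominator_ne_zero k x q, fun _ _ _ => rfl⟩

lemma holomorphicNear_F2Continuation (k : ℕ) {x : ℝ} {s u : ℂ} (hx : 0 < x)
    (h1 : NotGammaPole (1 - s + u + weightShift k)) (h2 : x = 1 → NotGammaPole (2 * s - 1)) :
    HolomorphicNear (fun p => F2Continuation k x p.1 p.2) (s, u) := by
  refine ⟨{q | F2Denominator k x q ≠ 0}, ?_, F2Denominator_ne_zero h1 h2, ?_⟩
  · exact isOpen_ne_fun (differentiable_F2Denominator k x).continuous continuous_const
  · intro q hq
    simp only [F2Continuation, div_eq_mul_inv]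
    exact ((differentiable_F2EntireFactor k hx q).fun_mul
      ((differentiable_F2Denominator k x q).fun_inv hq)).differentiableWithinAt

lemma F2Continuation_of_one_lt (k : ℕ) {x : ℝ} (hx : 1 < x) (s u : ℂ) :
    F2Continuation k x s u = -I ^ k * (Gamma (1 - s + u + weightShift k) *
      (Gamma (s - u + weightShift k))⁻¹ * (x : ℂ) ^ (-u) *
      regularizedGaussHGFun (1 - s + u + weightShift k) (1 - s + u - weightShift k)
        (1 + 2 * u) (x⁻¹ : ℝ)) := by
  simp only [F2Continuation, F2EntireFactor, F2Denominator, hx, if_true, hx.ne', if_false,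
    mul_one, div_inv_eq_mul]
  ring

lemma F2Continuation_one (k : ℕ) (s u : ℂ) :
    F2Continuation k 1 s u = -I ^ k * Gamma (2 * s - 1) * Gamma (1 - s + u + weightShift k) /
          (Gamma (s + u - weightShift k) * Gamma (s + u + weightShift k)
            * Gamma (s - u + weightShift k)) := by
  simp only [F2Continuation, F2EntireFactor, F2Denominator, lt_irrefl, if_true, if_false,
    div_eq_mul_inv, mul_inv, inv_inv]
  ring

lemma F2Continuation_of_lt_one (k : ℕ) {x : ℝ} (hx : x < 1) (s u : ℂ) :
    F2Continuation k x s u = -I ^ k * (Gamma (1 - s + u + weightShift k) *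
      (Gamma (s + u - weightShift k))⁻¹ * (x : ℂ) ^ (1 - s + weightShift k) *
      regularizedGaussHGFun (1 - s + u + weightShift k) (1 - s - u + weightShift k) k x) := by
  simp only [F2Continuation, F2EntireFactor, F2Denominator, not_lt.2 hx.le, hx.ne, if_false,
    mul_one, div_inv_eq_mul]
  ring

lemma F2Continuation_eq_F2HypLarge (k : ℕ) {x : ℝ} (hx : 1 < x) {s u : ℂ}
    (hu : NotGammaPole (1 + 2 * u)) : F2Continuation k x s u = F2HypLarge s u k x := by
  rw [F2Continuation_of_one_lt k hx, ← ordinaryHypergeometric_div_Gamma_eq hu, F2HypLarge,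
    Complex.ofReal_inv]
  simp only [div_eq_mul_inv, mul_inv]
  ring

lemma F2Continuation_eq_F2HypSmall {k : ℕ} (hk : 1 ≤ k) {x : ℝ} (hx : x < 1) (s u : ℂ) :
    F2Continuation k x s u = F2HypSmall s u k x := by
  have hk' : ∀ m : ℕ, (k : ℂ) ≠ -(m : ℂ) :=
    ne_neg_nat_of_re_pos (by simpa using Nat.lt_of_lt_of_le Nat.zero_lt_one hk)
  rw [F2Continuation_of_lt_one k hx, ← ordinaryHypergeometric_div_Gamma_eq hk', F2HypSmall]
  simp only [div_eq_mul_inv, mul_inv]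
  ring

lemma F2Continuation_eq_F2AtOne (k : ℕ) {s u : ℂ}
    (h : NotGammaPole (1 - s - u + weightShift k)) : F2Continuation k 1 s u = F2AtOne s u k := by
  have e : 1 - s - u + weightShift k = 1 - (s + u - weightShift k) := by ring
  rw [e] at h
  have h1 := inv_Gamma_eq_sin_mul_Gamma h
  rw [F2Continuation_one, F2AtOne, e]
  simp only [div_eq_mul_inv, mul_inv] at h1 ⊢
  rw [← h1]
  ring

lemma verticalIntegrable_F2Integrand {s u : ℂ} {ε : ℝ} (k : ℕ) (hs : 1 / 2 < s.re) (hε : 0 < ε)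
    (hk : 1 ≤ k) (hu : s.re + ε < u.re) {x : ℝ} (hx : 0 < x) :
    VerticalIntegrable (F2Integrand s u k x) (-s.re - ε) := by
  have hk' : (1 : ℝ) ≤ k := by exact_mod_cast hk
  refine verticalIntegrable_mul_cpow (inv_pos.2 hx) (verticalIntegrable_gammaQuotient
    (by linarith) ?_ ?_) (F2Integrand_eq_gammaQuotient s u k hx)
  · simp only [add_re, sub_re, one_re, weightShift_re]; linarith
  · simp only [add_re, sub_re, one_re, weightShift_re]; linarith

lemma F2_eq_F2Continuation {s u : ℂ} {ε : ℝ} {k : ℕ} (hk : 1 ≤ k) (hs : 1 / 2 < s.re)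
    (hε : 0 < ε) (hu : s.re + ε < u.re) {x : ℝ} (hx : 0 < x) :
    F2 ε s u k x = F2Continuation k x s u := by
  have hk' : (1 : ℝ) ≤ k := by exact_mod_cast hk
  have hp : 0 < u.re + (-s.re - ε) := by linarith
  have hq : 0 < (1 - s + weightShift k).re - (-s.re - ε) := by
    simp only [add_re, sub_re, one_re, weightShift_re]; linarith
  have hS : 1 < ((s + weightShift k) + (1 + u) - u - (1 - s + weightShift k)).re := by
    simp only [add_re, sub_re, one_re, weightShift_re]; linarith
  have hx0 : (x : ℂ) ≠ 0 := Complex.ofReal_ne_zero.2 hx.ne'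
  rw [F2, verticalIntegral_eq_mellinInv (F2Integrand_eq_gammaQuotient s u k hx)]
  rcases lt_trichotomy x 1 with h | h | h
  -- Here 1/x > 1 lies outside the unit interval, so the integral is first turned over by v ↦ -v.
  · rw [mellinInv_gammaQuotient_inv _ _ _ _ _ (inv_pos.2 hx), inv_inv,
      mellinInv_gammaQuotient (by linarith) (by linarith) ?_ hx h, F2Continuation_of_lt_one k h,
      gaussValue, regularizedGaussHGFun_symm]
    · have e1 : 1 - s + weightShift k + u = 1 - s + u + weightShift k := by ring
      have e2 : 1 + u - (1 - s + weightShift k) = s + u - weightShift k := by ring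
      have e3 : 1 - (1 + u) + (1 - s + weightShift k) = 1 - s - u + weightShift k := by ring
      have e4 : s + weightShift k + (1 - s + weightShift k) = k := by
        rw [weightShift]; ring
      rw [e1, e2, e3, e4]
      ring
    · simp only [add_re, sub_re, one_re, weightShift_re] at hS ⊢; linarith
  · subst h
    rw [inv_one, mellinInv_gammaQuotient_one hp hq hS, F2Continuation_one, gaussValueOne]
    have e1 : u + (1 - s + weightShift k) = 1 - s + u + weightShift k := by ring
    have e2 : s + weightShift k + (1 + u) - u - (1 - s + weightShift k) - 1 = 2 * s - 1 := by ring
    have e3 : s + weightShift k - u = s - u + weightShift k := by ring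
    have e4 : 1 + u - (1 - s + weightShift k) = s + u - weightShift k := by ring
    have e5 : s + weightShift k + (1 + u) - 1 = s + u + weightShift k := by ring
    rw [e1, e2, e3, e4, e5]
    simp only [div_eq_mul_inv, mul_inv]
    ring
  · rw [mellinInv_gammaQuotient hp hq hS (inv_pos.2 hx) (inv_lt_one_of_one_lt₀ h),
      F2Continuation_of_one_lt k h, gaussValue, regularizedGaussHGFun_symm]
    have e1 : u + (1 - s + weightShift k) = 1 - s + u + weightShift k := by ring
    have e2 : s + weightShift k - u = s - u + weightShift k := by ring
    have e3 : 1 - (s + weightShift k) + u = 1 - s + u - weightShift k := by ring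
    have e4 : 1 + u + u = 1 + 2 * u := by ring
    have e5 : ((x⁻¹ : ℝ) : ℂ) ^ u = (x : ℂ) ^ (-u) := by
      rw [ofReal_cpow_eq_exp (inv_pos.2 hx), ofReal_cpow_eq_exp hx, Real.log_inv]
      push_cast; ring_nf
    rw [e1, e2, e3, e4, e5]
    ring

/-! ### The Barnes integral for x > 1 and the bound. -/

section BarnesLarge

variable {k : ℕ} {s u : ℂ} {σ x : ℝ}

lemma verticalIntegral_barnesIntegrandLarge :
    verticalIntegral σ (barnesIntegrandLarge s u k x) = mellinInv σ (fun v =>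
      Gamma (1 - s + weightShift k + v) * Gamma (s + weightShift k + v) * Gamma (u - v) /
        Gamma (1 + u + v)) (x - 1) :=
  verticalIntegral_eq_mellinInv fun _ => rfl

lemma verticalIntegrable_barnesIntegrandLarge (hs : 1 / 2 ≤ s.re) (hx : 1 < x)
    (hσ : -1 + s.re - ((k : ℝ) - 1) / 2 < σ) (hσu : σ < u.re) :
    VerticalIntegrable (barnesIntegrandLarge s u k x) σ := by
  refine verticalIntegrable_mul_cpow (w := x - 1) (by linarith)
    (verticalIntegrable_barnes_three (a := 1 - s + weightShift k) (b := s + weightShift k)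
      (u := u) (c := 1 + u) ?_ ?_ (by linarith)) fun v => rfl
  -- The lower bound on σ is exactly positivity for 1-s+κ+v; with Re s ≥ 1/2 it also gives Re(s+κ)+σ
  -- > 2 Re s - 1 ≥ 0 for the other Gamma.
  · simp only [add_re, sub_re, one_re, weightShift_re]; linarith
  · simp only [add_re, weightShift_re]; linarith

lemma F2Continuation_eq_barnesIntegralLarge (hs : 1 / 2 ≤ s.re) (hx : 1 < x)
    (hσ : -1 + s.re - ((k : ℝ) - 1) / 2 < σ) (hσu : σ < u.re) :
    F2Continuation k x s u = -I ^ k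
      * (1 / (Gamma (s - u + weightShift k) * Gamma (s + u + weightShift k)))
      * ((x / (x - 1) : ℝ) : ℂ) ^ (1 - s + weightShift k)
      * verticalIntegral σ (barnesIntegrandLarge s u k x) := by
  have hw : 0 < x - 1 := by linarith
  have hx0 : 0 < x := by linarith
  have hM := mellinInv_barnes_three (a := 1 - s + weightShift k) (b := s + weightShift k)
      (u := u) (c := 1 + u) (σ := σ) (x := x)
      (by simp only [add_re, sub_re, one_re, weightShift_re]; linarith)
      (by simp only [add_re, weightShift_re]; linarith) (by linarith) hx
  rw [verticalIntegral_barnesIntegrandLarge, hM,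
    F2Continuation_of_one_lt k hx]
  have hG : Gamma (s + u + weightShift k) ≠ 0 := Complex.Gamma_ne_zero_of_re_pos (by
    simp only [add_re, weightShift_re]; linarith)
  have e1 : 1 - s + weightShift k + u = 1 - s + u + weightShift k := by ring
  have e2 : s + weightShift k + u = s + u + weightShift k := by ring
  have e3 : 1 + u - (s + weightShift k) = 1 - s + u - weightShift k := by ring
  have e4 : 1 + u + u = 1 + 2 * u := by ring
  have e5 : ((x / (x - 1) : ℝ) : ℂ) ^ (1 - s + weightShift k) *
      (((x - 1 : ℝ) : ℂ) ^ (1 - s + weightShift k) * (x : ℂ) ^ (-(1 - s + u + weightShift k)))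
      = (x : ℂ) ^ (-u) := by
    rw [ofReal_cpow_eq_exp (div_pos hx0 hw), ofReal_cpow_eq_exp hw, ofReal_cpow_eq_exp hx0,
      ofReal_cpow_eq_exp hx0, Real.log_div hx0.ne' hw.ne', ← Complex.exp_add, ← Complex.exp_add]
    congr 1
    push_cast
    ring
  rw [e1, e2, e3, e4, ← e5]
  simp only [div_eq_mul_inv, mul_inv, one_mul]
  field_simp

lemma F2Continuation_eq_barnesIntegralLarge_sin (hs : 1 / 2 ≤ s.re) (hx : 1 < x)
    (hσ : -1 + s.re - ((k : ℝ) - 1) / 2 < σ) (hσu : σ < u.re)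
    (hp : NotGammaPole (1 - s + u - weightShift k)) :
    F2Continuation k x s u = -I ^ k * (Complex.sin (Real.pi * (s - u + weightShift k)) / Real.pi)
      * (Gamma (1 - s + u - weightShift k) / Gamma (s + u + weightShift k))
      * ((x / (x - 1) : ℝ) : ℂ) ^ (1 - s + weightShift k)
      * verticalIntegral σ (barnesIntegrandLarge s u k x) := by
  have e : 1 - s + u - weightShift k = 1 - (s - u + weightShift k) := by ring
  rw [e] at hp
  have h1 := inv_Gamma_eq_sin_mul_Gamma hp
  rw [F2Continuation_eq_barnesIntegralLarge hs hx hσ hσu, e]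
  simp only [div_eq_mul_inv, mul_inv, one_mul] at h1 ⊢
  rw [← h1]
  ring

end BarnesLarge

lemma norm_regularizedGaussHGFun_le (a b c : ℂ) {r : ℝ} (hr0 : 0 ≤ r) (hr : r < 1) :
    ∃ B : ℝ, 0 ≤ B ∧ ∀ z : ℂ, ‖z‖ ≤ r → ‖regularizedGaussHGFun a b c z‖ ≤ B := by
  have hrn : ‖(r : ℂ)‖ < 1 := by rwa [Complex.norm_real, Real.norm_of_nonneg hr0]
  have hs := summable_norm_regularizedGaussHG a b c hrn
  refine ⟨_, hs.hasSum.nonneg fun n => norm_nonneg _, fun z hz => ?_⟩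
  rw [regularizedGaussHGFun_eq_tsum]
  refine tsum_of_norm_bounded hs.hasSum fun n => ?_
  rw [norm_mul, norm_mul, norm_pow, norm_pow, Complex.norm_real, Real.norm_of_nonneg hr0]
  gcongr

/-- For x ≥ 2 the series is evaluated at |1/x| ≤ 1/2, where it is bounded, x/(x-1) lies in [1,2],
and the decay comes from x^(-u). -/
lemma exists_norm_F2Continuation_le_of_two_le (k : ℕ) (s : ℂ) {u : ℂ} (hu : 0 < u.re) :
    ∃ C : ℝ, 0 ≤ C ∧ ∀ x : ℝ, 2 ≤ x →
      ‖((x / (x - 1) : ℝ) : ℂ) ^ (-1 + s - weightShift k) * F2Continuation k x s u‖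
        ≤ C * (x - 1) ^ (-u.re) := by
  obtain ⟨B, hB0, hB⟩ := norm_regularizedGaussHGFun_le (1 - s + u + weightShift k)
    (1 - s + u - weightShift k) (1 + 2 * u) (r := 1 / 2) (by norm_num) (by norm_num)
  set e := (-1 + s - weightShift k).re with he
  set K := ‖-I ^ k * (Gamma (1 - s + u + weightShift k) * (Gamma (s - u + weightShift k))⁻¹)‖
  refine ⟨2 ^ |e| * (K * B), by positivity, fun x hx => ?_⟩
  have hw : 0 < x - 1 := by linarith
  have hx0 : 0 < x := by linarith
  have h1 : 1 ≤ x / (x - 1) := by rw [le_div_iff₀ hw]; linarith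
  have h2 : x / (x - 1) ≤ 2 := by rw [div_le_iff₀ hw]; linarith
  have h3 : (x / (x - 1)) ^ e ≤ 2 ^ |e| :=
    (Real.rpow_le_rpow_of_exponent_le h1 (le_abs_self e)).trans
      (Real.rpow_le_rpow (by linarith) h2 (abs_nonneg e))
  have h4 : x ^ (-u.re) ≤ (x - 1) ^ (-u.re) :=
    Real.rpow_le_rpow_of_nonpos hw (by linarith) (by linarith)
  have h5 : ‖((x⁻¹ : ℝ) : ℂ)‖ ≤ 1 / 2 := by
    rw [Complex.norm_real, Real.norm_of_nonneg (by positivity), inv_eq_one_div]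
    exact one_div_le_one_div_of_le two_pos hx
  rw [F2Continuation_of_one_lt k (by linarith), ← mul_assoc (-I ^ k), ← mul_assoc (-I ^ k),
    norm_mul, norm_mul _ (regularizedGaussHGFun _ _ _ _), norm_mul _ ((x : ℂ) ^ (-u)),
    Complex.norm_cpow_eq_rpow_re_of_pos (by linarith),
    Complex.norm_cpow_eq_rpow_re_of_pos hx0, Complex.neg_re]
  calc (x / (x - 1)) ^ e * (K * x ^ (-u.re) * _) ≤ 2 ^ |e| * (K * (x - 1) ^ (-u.re) * B) := by
        gcongr
        exact hB _ h5
    _ = _ := by ring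

/-- Near x = 1 the Barnes integral on Re v = Re s is O((x-1)^(-Re s)), which is enough because 0 <
x-1 < 1 and Re s < Re u. -/
lemma exists_norm_F2Continuation_le_of_lt_two {k : ℕ} (hk : 1 ≤ k) {s u : ℂ}
    (hs : 1 / 2 ≤ s.re) (hu : s.re < u.re) :
    ∃ C : ℝ, 0 ≤ C ∧ ∀ x : ℝ, 1 < x → x < 2 →
      ‖((x / (x - 1) : ℝ) : ℂ) ^ (-1 + s - weightShift k) * F2Continuation k x s u‖
        ≤ C * (x - 1) ^ (-u.re) := by
  have hk' : (1 : ℝ) ≤ k := by exact_mod_cast hk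
  have hσ : -1 + s.re - ((k : ℝ) - 1) / 2 < s.re := by linarith
  set M : ℂ → ℂ := fun v => Gamma (1 - s + weightShift k + v) * Gamma (s + weightShift k + v) *
    Gamma (u - v) / Gamma (1 + u + v)
  set N := 1 / (2 * Real.pi) * ∫ t : ℝ, ‖M (s.re + t * I)‖
  have hN : 0 ≤ N := mul_nonneg (by positivity) (integral_nonneg fun t => norm_nonneg _)
  set K := ‖-I ^ k * (1 / (Gamma (s - u + weightShift k) * Gamma (s + u + weightShift k)))‖
  refine ⟨K * N, by positivity, fun x hx hx2 => ?_⟩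
  have hw : 0 < x - 1 := by linarith
  have hx0 : 0 < x := by linarith
  have hcancel : ((x / (x - 1) : ℝ) : ℂ) ^ (-1 + s - weightShift k) *
      ((x / (x - 1) : ℝ) : ℂ) ^ (1 - s + weightShift k) = 1 := by
    rw [← Complex.cpow_add _ _ (Complex.ofReal_ne_zero.2 (div_pos hx0 hw).ne'),
      show -1 + s - weightShift k + (1 - s + weightShift k) = 0 by ring, Complex.cpow_zero]
  rw [F2Continuation_eq_barnesIntegralLarge hs hx hσ hu,
    verticalIntegral_barnesIntegrandLarge]
  have hre : ∀ P Q R T : ℂ, P * Q = 1 → P * (R * Q * T) = R * T := by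
    intro P Q R T h
    linear_combination R * T * h
  rw [hre _ _ _ _ hcancel, norm_mul, mul_assoc K]
  refine mul_le_mul_of_nonneg_left ((norm_mellinInv_le _ _ hw).trans ?_) (norm_nonneg _)
  rw [mul_comm N]
  exact mul_le_mul_of_nonneg_right
    (Real.rpow_le_rpow_of_exponent_ge hw (by linarith) (by linarith)) hN

lemma exists_norm_F2Continuation_le {k : ℕ} (hk : 1 ≤ k) {s u : ℂ}
    (hs : 1 / 2 ≤ s.re) (hu : s.re < u.re) :
    ∃ C : ℝ, ∀ x : ℝ, 1 < x →
      ‖((x / (x - 1) : ℝ) : ℂ) ^ (-1 + s - weightShift k) * F2Continuation k x s u‖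
        ≤ C * (x - 1) ^ (-u.re) := by
  obtain ⟨C₁, h₁, hC₁⟩ := exists_norm_F2Continuation_le_of_two_le k s (u := u) (by linarith)
  obtain ⟨C₂, h₂, hC₂⟩ := exists_norm_F2Continuation_le_of_lt_two hk hs hu
  refine ⟨C₁ + C₂, fun x hx => ?_⟩
  have hp : 0 ≤ (x - 1) ^ (-u.re) := Real.rpow_nonneg (by linarith) _
  rcases le_or_gt 2 x with h | h
  · exact (hC₁ x h).trans (by gcongr; linarith)
  · exact (hC₂ x hx h).trans (by gcongr; linarith)

/-! ### The Barnes integral for 0 < x < 1. -/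

section BarnesSmall

variable {k : ℕ} {s u : ℂ} {σ x : ℝ}

lemma barnesIntegrandSmall_eq (s u : ℂ) (k : ℕ) (x : ℝ) (v : ℂ) :
    barnesIntegrandSmall s u k x v = Gamma (1 - s + weightShift k + v) *
      Gamma (s + weightShift k + v) * Gamma (u - v) * Gamma (-u - v) *
      ((1 - x : ℝ) : ℂ) ^ (-v) := by
  rw [barnesIntegrandSmall]; ring

lemma verticalIntegrable_barnesIntegrandSmall (hs : 1 / 2 ≤ s.re) (hx : x < 1)
    (hσ : -1 + s.re - ((k : ℝ) - 1) / 2 < σ) (hσu : σ < -|u.re|) :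
    VerticalIntegrable (barnesIntegrandSmall s u k x) σ := by
  have h1 := le_abs_self u.re
  have h2 := neg_abs_le u.re
  refine verticalIntegrable_mul_cpow (w := 1 - x) (by linarith)
    (verticalIntegrable_barnes_four (a := 1 - s + weightShift k) (b := s + weightShift k)
      (p := u) (q := -u) ?_ ?_ (by linarith) (by simp only [neg_re]; linarith))
      (barnesIntegrandSmall_eq s u k x)
  · simp only [add_re, sub_re, one_re, weightShift_re]; linarith
  · simp only [add_re, weightShift_re]; linarith

lemma F2Continuation_eq_barnesIntegralSmall (hs : 1 / 2 ≤ s.re) (hx : 0 < x) (hx1 : x < 1)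
    (hσ : -1 + s.re - ((k : ℝ) - 1) / 2 < σ) (hσu : σ < -|u.re|) :
    F2Continuation k x s u = -I ^ k
      * (Complex.sin (Real.pi * (s + u - weightShift k)) / Real.pi)
      * (1 / (Gamma (s - u + weightShift k) * Gamma (s + u + weightShift k)))
      * ((x / (1 - x) : ℝ) : ℂ) ^ (1 - s + weightShift k)
      * verticalIntegral σ (barnesIntegrandSmall s u k x) := by
  have h1 := le_abs_self u.re
  have h2 := neg_abs_le u.re
  have hw : 0 < 1 - x := by linarith
  have hM := mellinInv_barnes_four (a := 1 - s + weightShift k) (b := s + weightShift k)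
      (p := u) (q := -u) (σ := σ) (x := x)
      (by simp only [add_re, sub_re, one_re, weightShift_re]; linarith)
      (by simp only [add_re, weightShift_re]; linarith) (by linarith)
      (by simp only [neg_re]; linarith) hx hx1
  rw [verticalIntegral_eq_mellinInv (w := 1 - x) (barnesIntegrandSmall_eq s u k x), hM,
    F2Continuation_of_lt_one k hx1]
  -- The interval for σ is nonempty, so 1 - Re s + κ > |Re u|. With Re s ≥ 1/2 this makes the real
  -- parts of s ± u + κ and of 1-s-u+κ positive, so the reflection formula needs no exceptional
  -- case.
  have hG1 : Gamma (s + u + weightShift k) ≠ 0 := Complex.Gamma_ne_zero_of_re_pos (by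
    simp only [add_re, weightShift_re]; linarith)
  have hG2 : Gamma (s - u + weightShift k) ≠ 0 := Complex.Gamma_ne_zero_of_re_pos (by
    simp only [add_re, sub_re, weightShift_re]; linarith)
  have hr := inv_Gamma_eq_sin_mul_Gamma (z := s + u - weightShift k)
    (ne_neg_nat_of_re_pos (by simp only [add_re, sub_re, one_re, weightShift_re]; linarith))
  have e1 : 1 - s + weightShift k + u = 1 - s + u + weightShift k := by ring
  have e2 : s + weightShift k + u = s + u + weightShift k := by ring
  have e3 : 1 - s + weightShift k + -u = 1 - s - u + weightShift k := by ring
  have e4 : s + weightShift k + -u = s - u + weightShift k := by ring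
  have e5 : 1 - s + weightShift k + (s + weightShift k) + u + -u = k := by
    rw [weightShift]; ring
  have e6 : 1 - (s + u - weightShift k) = 1 - s - u + weightShift k := by ring
  have e7 : ((x / (1 - x) : ℝ) : ℂ) ^ (1 - s + weightShift k) *
      ((1 - x : ℝ) : ℂ) ^ (1 - s + weightShift k) = (x : ℂ) ^ (1 - s + weightShift k) := by
    rw [ofReal_cpow_eq_exp (div_pos hx hw), ofReal_cpow_eq_exp hw, ofReal_cpow_eq_exp hx,
      Real.log_div hx.ne' hw.ne', ← Complex.exp_add]
    congr 1
    push_cast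
    ring
  rw [e6] at hr
  rw [e1, e2, e3, e4, e5, ← e7, ← hr]
  simp only [div_eq_mul_inv, mul_inv, one_mul]
  field_simp

end BarnesSmall

end MellinBarnes

theorem mainTheorem7 (k : ℕ) (hk : 1 ≤ k) :
    -- the explicit formulas for the Mellin-Barnes integral, which converges absolutely
    (∀ (s u : ℂ) (ε : ℝ), 1 / 2 < s.re → 0 < ε → s.re + ε < u.re →
      (∀ x : ℝ, 0 < x → VerticalIntegrable (F2Integrand s u k x) (-s.re - ε)) ∧
      (∀ x : ℝ, 1 < x → F2 ε s u k x = F2HypLarge s u k x) ∧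
      (NotGammaPole (1 - s - u + weightShift k) → F2 ε s u k 1 = F2AtOne s u k) ∧
      -- the same value at x = 1 after the reflection formula, at all parameters
      (F2 ε s u k 1 = -I ^ k * Gamma (2 * s - 1) * Gamma (1 - s + u + weightShift k) /
          (Gamma (s + u - weightShift k) * Gamma (s + u + weightShift k)
            * Gamma (s - u + weightShift k))) ∧
      (∀ x : ℝ, 0 < x → x < 1 → F2 ε s u k x = F2HypSmall s u k x)) ∧
    -- the meromorphic continuation `G x s u` of `F₂(s, u, k; x)`
    ∃ G : ℝ → ℂ → ℂ → ℂ,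
      (∀ (x : ℝ) (s u : ℂ) (ε : ℝ), 0 < x → 1 / 2 < s.re → 0 < ε → s.re + ε < u.re →
        G x s u = F2 ε s u k x) ∧
      (∀ x : ℝ, 0 < x → MeromorphicOnC2 (fun p => G x p.1 p.2)) ∧
      -- it is holomorphic off the poles of the Gamma factors and given there by the formulas
      (∀ (x : ℝ) (s u : ℂ), 0 < x → NotGammaPole (1 - s + u + weightShift k) →
        (x = 1 → NotGammaPole (2 * s - 1)) →
        HolomorphicNear (fun p => G x p.1 p.2) (s, u)) ∧
      (∀ (x : ℝ) (s u : ℂ), 1 < x → NotGammaPole (1 - s + u + weightShift k) →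
        NotGammaPole (1 + 2 * u) → G x s u = F2HypLarge s u k x) ∧
      (∀ s u : ℂ, NotGammaPole (1 - s + u + weightShift k) → NotGammaPole (2 * s - 1) →
        NotGammaPole (1 - s - u + weightShift k) → G 1 s u = F2AtOne s u k) ∧
      (∀ (x : ℝ) (s u : ℂ), 0 < x → x < 1 → NotGammaPole (1 - s + u + weightShift k) →
        G x s u = F2HypSmall s u k x) ∧
      -- integral representations and the bound
      ∀ s u : ℂ, 1 / 2 ≤ s.re → s.re < u.re →
        (∀ x σ : ℝ, 1 < x → -1 + s.re - ((k : ℝ) - 1) / 2 < σ → σ < u.re →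
          VerticalIntegrable (barnesIntegrandLarge s u k x) σ ∧
          (NotGammaPole (1 - s + u - weightShift k) →
            G x s u = -I ^ k * (Complex.sin (Real.pi * (s - u + weightShift k)) / Real.pi)
              * (Gamma (1 - s + u - weightShift k) / Gamma (s + u + weightShift k))
              * ((x / (x - 1) : ℝ) : ℂ) ^ (1 - s + weightShift k)
              * verticalIntegral σ (barnesIntegrandLarge s u k x)) ∧
          -- the same representation after the reflection formula, at all parameters
          G x s u = -I ^ k
            * (1 / (Gamma (s - u + weightShift k) * Gamma (s + u + weightShift k)))
            * ((x / (x - 1) : ℝ) : ℂ) ^ (1 - s + weightShift k)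
            * verticalIntegral σ (barnesIntegrandLarge s u k x)) ∧
        (∃ C : ℝ, ∀ x : ℝ, 1 < x →
          ‖((x / (x - 1) : ℝ) : ℂ) ^ (-1 + s - weightShift k) * G x s u‖
            ≤ C * (x - 1) ^ (-u.re)) ∧
        (∀ x σ : ℝ, 0 < x → x < 1 → -1 + s.re - ((k : ℝ) - 1) / 2 < σ → σ < -|u.re| →
          VerticalIntegrable (barnesIntegrandSmall s u k x) σ ∧
          G x s u = -I ^ k * (Complex.sin (Real.pi * (s + u - weightShift k)) / Real.pi)
            * (1 / (Gamma (s - u + weightShift k) * Gamma (s + u + weightShift k)))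
            * ((x / (1 - x) : ℝ) : ℂ) ^ (1 - s + weightShift k)
            * verticalIntegral σ (barnesIntegrandSmall s u k x)) := by
  have hpole : ∀ {z : ℂ}, 0 < z.re → NotGammaPole z := fun hz => ne_neg_nat_of_re_pos hz
  refine ⟨fun s u ε hs hε hu => ⟨fun x hx => verticalIntegrable_F2Integrand k hs hε hk hu hx,
    fun x hx => ?_, fun h => ?_, ?_, fun x hx hx1 => ?_⟩, F2Continuation k,
    fun x s u ε hx hs hε hu => (F2_eq_F2Continuation hk hs hε hu hx).symm,
    fun x hx => meromorphicOnC2_F2Continuation k hx,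
    fun x s u hx h1 h2 => holomorphicNear_F2Continuation k hx h1 h2,
    fun x s u hx _ hu => F2Continuation_eq_F2HypLarge k hx hu,
    fun s u _ _ h => F2Continuation_eq_F2AtOne k h,
    fun x s u _ hx1 _ => F2Continuation_eq_F2HypSmall hk hx1 s u,
    fun s u hs hu => ⟨fun x σ hx hσ hσu =>
      ⟨verticalIntegrable_barnesIntegrandLarge hs hx hσ hσu,
        fun h => F2Continuation_eq_barnesIntegralLarge_sin hs hx hσ hσu h,
        F2Continuation_eq_barnesIntegralLarge hs hx hσ hσu⟩,
      exists_norm_F2Continuation_le hk hs hu,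
      fun x σ hx hx1 hσ hσu => ⟨verticalIntegrable_barnesIntegrandSmall hs hx1 hσ hσu,
        F2Continuation_eq_barnesIntegralSmall hs hx hx1 hσ hσu⟩⟩⟩
  · rw [F2_eq_F2Continuation hk hs hε hu (by linarith)]
    -- Re u > Re s > 1/2, so 1+2u has positive real part.
    exact F2Continuation_eq_F2HypLarge k hx (hpole (by simp; linarith))
  · rw [F2_eq_F2Continuation hk hs hε hu one_pos]
    exact F2Continuation_eq_F2AtOne k h
  · rw [F2_eq_F2Continuation hk hs hε hu one_pos, F2Continuation_one]
  · rw [F2_eq_F2Continuation hk hs hε hu hx]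
    exact F2Continuation_eq_F2HypSmall hk hx1 s u
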